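/- **Notation.** $(z)_n=z(z+1)\cdots(z+n-1)$. All integrals are along vertical lines, upwards. For complex parameters $h=(h_0,h_{-1};h_1,\dots,h_6)$ with $\max\{0,\Re(h_0-h_{-1})\}<\Re h_j<\tfrac12\Re h_0$ for $j=1,\dots,6$ put $$F_6'(h)=\frac1{2\pi i}\int_{c-i\infty}^{c+i\infty}(h_0+2t)\,\frac{\prod_{j=-1}^6\Gamma(h_j+t)\cdot\Gamma(h_{-1}-h_0-t)\,\Gamma(-t)}{\prod_{j=1}^6\Gamma(1+h_0-h_j+t)}\,dt,$$ where $-\min_{1\le j\le 6}\Re h_j<c<\min\{0,\Re(h_{-1}-h_0)\}$. Below, the $s$-integral (with inner parameters $h_i,h_j,h_l$) runs along any line $\Re s=c_s$ with $$-\min\{\Re h_i,\Re h_j,\Re h_l\}<c_s<\min\{0,\ \Re(h_{-1}-h_0),\ \Re(1+h_0-h_i-h_j-h_l)\},$$ where $(i,j,l)=(1,2,3)$ in part (A) and $(1,3,5)$ in part (B); the $t$-integral runs along any line $\Re t=c_t$ satisfying the same condition with $(4,5,6)$ in (A) and $(2,4,6)$ in (B). **(A)** Let $h$ be as above and assume $h_{-1}-h_0\in\mathbb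 Z$, $h_0-h_1-h_2-h_3\in\mathbb Z$ and $h_0-h_4-h_5-h_6\in\mathbb Z$. Then all integrals below converge absolutely and $$\begin{aligned}F_6'(h)&=\frac{(-1)^{1+(h_{-1}-h_0)+(h_0-h_1-h_2-h_3)+(h_0-h_4-h_5-h_6)}\,\Gamma(h_{-1})}{\Gamma(1+h_0-h_1-h_2)\Gamma(1+h_0-h_1-h_3)\Gamma(1+h_0-h_2-h_3)}\\ &\times\frac1{\Gamma(1+h_0-h_4-h_5)\Gamma(1+h_0-h_4-h_6)\Gamma(1+h_0-h_5-h_6)}\\ &\times\frac1{2\pi i}\int\frac{\Gamma(h_4+t)\Gamma(h_5+t)\Gamma(h_6+t)}{\Gamma(1+t)\Gamma(1+h_0-h_{-1}+t)\Gamma(h_4+h_5+h_6-h_0+t)}\Bigl(\frac{\pi}{\sin\pi t}\Bigr)^3\\ &\times\frac1{2\pi i}\int\frac{\Gamma(h_1+s)\Gamma(h_2+s)\Gamma(h_3+s)}{\Gamma(1+s)\Gamma(1+h_0-h_{-1}+s)\Gamma(h_1+h_2+h_3-h_0+s)}\Bigl(\frac{\pi}{\sin\pi s}\Bigr)^3\,\frac{\Gamma(1+h_0-h_{-1}+s+t)}{\Gamma(1+h_0+s+t)}\,\frac{\sin\pi(s+t)}{\pi}\,ds\,dt.\end{aligned}$$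 **(B)** Let $h_0,h_{-1},h_1,\dots,h_6$ be positive integers with $h_0-h_{-1}<h_j<\tfrac12h_0$ for $j=1,\dots,6$, and let $F(h)=\gamma(h)F_6'(h)$ with $$\gamma(h)=\frac{(h_0-h_2-h_4)!\,(h_0-h_1-h_3)!\,(h_0-h_4-h_6)!\,(h_0-h_3-h_5)!}{(h_1-1)!\,(h_2-1)!\,(h_5+h_{-1}-h_0-1)!\,(h_6+h_{-1}-h_0-1)!}.$$ Then all integrals below converge absolutely and $$\begin{aligned}F(h)&=\frac{(-1)^{1+h_{-1}+h_0+h_1+\dots+h_6}\,(h_{-1}-1)!\,\gamma(h)}{(h_0-h_1-h_3)!\,(h_0-h_1-h_5)!\,(h_0-h_3-h_5)!\,(h_0-h_2-h_4)!\,(h_0-h_2-h_6)!\,(h_0-h_4-h_6)!}\\ &\times\frac1{2\pi i}\int\frac{\Gamma(h_2+t)\Gamma(h_4+t)\Gamma(h_6+t)}{\Gamma(1+t)\Gamma(1+h_0-h_{-1}+t)\Gamma(h_2+h_4+h_6-h_0+t)}\Bigl(\frac{\pi}{\sin\pi t}\Bigr)^3\\ &\times\frac1{2\pi i}\int\frac{\Gamma(h_1+s)\Gamma(h_3+s)\Gamma(h_5+s)}{\Gamma(1+s)\Gamma(1+h_0-h_{-1}+s)\Gamma(h_1+h_3+h_5-h_0+s)}\Bigl(\frac{\pi}{\sin\pi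 s}\Bigr)^3\,\frac{\Gamma(1+h_0-h_{-1}+s+t)}{\Gamma(1+h_0+s+t)}\,\frac{\sin\pi(s+t)}{\pi}\,ds\,dt\\ &=(-1)^{1+h_{-1}+h_0+h_1+\dots+h_6}\\ &\times\frac1{2\pi i}\int\frac{(t+1)_{h_2-1}}{(h_2-1)!}\,\frac{(t+h_2+h_4+h_6-h_0)_{h_0-h_2-h_6}}{(h_0-h_2-h_6)!}\,\frac{(t+1+h_0-h_{-1})_{h_6+h_{-1}-h_0-1}}{(h_6+h_{-1}-h_0-1)!}\Bigl(\frac{\pi}{\sin\pi t}\Bigr)^3\\ &\times\frac1{2\pi i}\int\frac{(s+1)_{h_1-1}}{(h_1-1)!}\,\frac{(s+h_1+h_3+h_5-h_0)_{h_0-h_1-h_5}}{(h_0-h_1-h_5)!}\,\frac{(s+1+h_0-h_{-1})_{h_5+h_{-1}-h_0-1}}{(h_5+h_{-1}-h_0-1)!}\Bigl(\frac{\pi}{\sin\pi s}\Bigr)^3\\ &\qquad\times\frac{(h_{-1}-1)!}{(s+t+1+h_0-h_{-1})_{h_{-1}}}\,\frac{\sin\pi(s+t)}{\pi}\,ds\,dt.\end{aligned}$$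 -/

import Mathlib

open MeasureTheory

noncomputable section

namespace BarnesZeta4

/-- `(1 / 2πi) ∫_{c - i∞}^{c + i∞} f(z) dz`, along the upward vertical line `Re z = c`. -/
def verticalIntegral (c : ℝ) (f : ℂ → ℂ) : ℂ :=
  (1 / (2 * (Real.pi : ℂ) * Complex.I)) *
    ∫ y : ℝ, f ((c : ℂ) + (y : ℂ) * Complex.I) * Complex.I

/-- Absolute convergence of the integral of `f` along the line `Re z = c`. -/
def VerticalIntegrable (c : ℝ) (f : ℂ → ℂ) : Prop :=
  Integrable (fun y : ℝ => f ((c : ℂ) + (y : ℂ) * Complex.I)) volume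

/-- The integrand of the very-well-poised integral with parameters
`(h₀, h₋₁; h₁, …, h_k)`; the parameter with index `j` is `h j`, `-1 ≤ j ≤ k`. -/
def vwpIntegrand (k : ℕ) (h : ℤ → ℂ) (t : ℂ) : ℂ :=
  (h 0 + 2 * t) *
    (((∏ j ∈ Finset.Icc (-1 : ℤ) k, Complex.Gamma (h j + t)) *
        Complex.Gamma (h (-1) - h 0 - t) * Complex.Gamma (-t)) /
      ∏ j ∈ Finset.Icc (1 : ℤ) k, Complex.Gamma (1 + h 0 - h j + t))

/-- `F_k'(h)`, taken along the line `Re t = c`. -/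
def vwpIntegral (k : ℕ) (h : ℤ → ℂ) (c : ℝ) : ℂ :=
  verticalIntegral c (vwpIntegrand k h)

/-- `max {0, Re (h₀ - h₋₁)} < Re h_j < Re h₀ / 2` for `j = 1, …, k`. -/
def AdmissibleParams (k : ℕ) (h : ℤ → ℂ) : Prop :=
  ∀ j ∈ Finset.Icc (1 : ℤ) k,
    max 0 (h 0 - h (-1)).re < (h j).re ∧ (h j).re < (1 / 2) * (h 0).re

/-- For admissible parameters, the line `Re t = c` has all poles of the `Γ(h_j + t)` on its left
and all poles of `Γ(h₋₁ - h₀ - t) Γ(-t)` on its right. -/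
def SeparatesVwp (k : ℕ) (h : ℤ → ℂ) (c : ℝ) : Prop :=
  (∀ j ∈ Finset.Icc (1 : ℤ) k, -(h j).re < c) ∧ c < 0 ∧ c < (h (-1) - h 0).re

/-- The line `Re z = c` has all poles of `Γ(h_i + z) Γ(h_j + z) Γ(h_l + z)` on its left and all
poles of `Γ(-z) Γ(h₋₁ - h₀ - z) Γ(1 + h₀ - h_i - h_j - h_l - z)` on its right. -/
def SeparatesTriple (h : ℤ → ℂ) (i j l : ℤ) (c : ℝ) : Prop :=
  (-(h i).re < c ∧ -(h j).re < c ∧ -(h l).re < c) ∧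
    c < 0 ∧ c < (h (-1) - h 0).re ∧ c < (1 + h 0 - h i - h j - h l).re

/-- `Γ(h_i+z)Γ(h_j+z)Γ(h_l+z) / (Γ(1+z)Γ(1+h₀-h₋₁+z)Γ(h_i+h_j+h_l-h₀+z)) · (π / sin πz)³`. -/
def gammaFactor (h : ℤ → ℂ) (i j l : ℤ) (z : ℂ) : ℂ :=
  (Complex.Gamma (h i + z) * Complex.Gamma (h j + z) * Complex.Gamma (h l + z)) /
      (Complex.Gamma (1 + z) * Complex.Gamma (1 + h 0 - h (-1) + z) *
        Complex.Gamma (h i + h j + h l - h 0 + z)) *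
    ((Real.pi : ℂ) / Complex.sin ((Real.pi : ℂ) * z)) ^ 3

/-- `Γ(1+h₀-h₋₁+x) / Γ(1+h₀+x) · sin(πx) / π`, to be used at `x = s + t`. -/
def gammaCoupling (h : ℤ → ℂ) (x : ℂ) : ℂ :=
  Complex.Gamma (1 + h 0 - h (-1) + x) / Complex.Gamma (1 + h 0 + x) *
    (Complex.sin ((Real.pi : ℂ) * x) / (Real.pi : ℂ))

/-- The iterated integral
`(1/2πi) ∫_{Re t = ct} A(t) · (1/2πi) ∫_{Re s = cs} B(s) K(s + t) ds dt`. -/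
def doubleIntegral (ct cs : ℝ) (A B K : ℂ → ℂ) : ℂ :=
  verticalIntegral ct (fun t => A t * verticalIntegral cs (fun s => B s * K (s + t)))

/-- Absolute convergence of the double integral, and of its inner integral for every `t`. -/
def DoubleIntegrable (ct cs : ℝ) (A B K : ℂ → ℂ) : Prop :=
  (∀ y : ℝ, VerticalIntegrable cs (fun s => B s * K (s + ((ct : ℂ) + (y : ℂ) * Complex.I)))) ∧
  Integrable (fun p : ℝ × ℝ =>
    A ((ct : ℂ) + (p.1 : ℂ) * Complex.I) *
      (B ((cs : ℂ) + (p.2 : ℂ) * Complex.I) *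
        K (((cs : ℂ) + (p.2 : ℂ) * Complex.I) + ((ct : ℂ) + (p.1 : ℂ) * Complex.I))))
    (volume.prod volume)

/-- `n!` for an integer `n`, as a complex number; only used for `n ≥ 0`. -/
def intFactorial (n : ℤ) : ℂ := (Nat.factorial n.toNat : ℂ)

/-- `(z)_n = z (z + 1) ⋯ (z + n - 1)` for an integer `n`; only used for `n ≥ 0`. -/
def pochhammer (z : ℂ) (n : ℤ) : ℂ := (ascPochhammer ℂ n.toNat).eval z

/-- Integer parameters `h₋₁, …, h₆` regarded as complex numbers. -/
def castParams (h : ℤ → ℤ) : ℤ → ℂ := fun j => (h j : ℂ)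

/-- `h₋₁, …, h₆` are positive integers with `h₀ - h₋₁ < h_j < h₀ / 2` for `j = 1, …, 6`. -/
def AdmissibleIntParams (h : ℤ → ℤ) : Prop :=
  (∀ j ∈ Finset.Icc (-1 : ℤ) 6, 0 < h j) ∧
    ∀ j ∈ Finset.Icc (1 : ℤ) 6, h 0 - h (-1) < h j ∧ 2 * h j < h 0

/-- The normalisation factor `γ(h)`. -/
def gammaNorm (h : ℤ → ℤ) : ℂ :=
  (intFactorial (h 0 - h 2 - h 4) * intFactorial (h 0 - h 1 - h 3) *
      intFactorial (h 0 - h 4 - h 6) * intFactorial (h 0 - h 3 - h 5)) /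
    (intFactorial (h 1 - 1) * intFactorial (h 2 - 1) *
      intFactorial (h 5 + h (-1) - h 0 - 1) * intFactorial (h 6 + h (-1) - h 0 - 1))

/-- `F(h) = γ(h) F₆'(h)`, taken along the line `Re t = c`. -/
def normalizedIntegral (h : ℤ → ℤ) (c : ℝ) : ℂ :=
  gammaNorm h * vwpIntegral 6 (castParams h) c

/-- `(z+1)_{h_i-1}/(h_i-1)! · (z+h_i+h_j+h_l-h₀)_{h₀-h_i-h_l}/(h₀-h_i-h_l)!
· (z+1+h₀-h₋₁)_{h_l+h₋₁-h₀-1}/(h_l+h₋₁-h₀-1)! · (π / sin πz)³`. -/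
def pochFactor (h : ℤ → ℤ) (i j l : ℤ) (z : ℂ) : ℂ :=
  (pochhammer (z + 1) (h i - 1) / intFactorial (h i - 1)) *
    (pochhammer (z + h i + h j + h l - h 0) (h 0 - h i - h l) /
      intFactorial (h 0 - h i - h l)) *
    (pochhammer (z + 1 + h 0 - h (-1)) (h l + h (-1) - h 0 - 1) /
      intFactorial (h l + h (-1) - h 0 - 1)) *
    ((Real.pi : ℂ) / Complex.sin ((Real.pi : ℂ) * z)) ^ 3

/-- `(h₋₁-1)! / (x+1+h₀-h₋₁)_{h₋₁} · sin(πx) / π`, to be used at `x = s + t`. -/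
def pochCoupling (h : ℤ → ℤ) (x : ℂ) : ℂ :=
  intFactorial (h (-1) - 1) / pochhammer (x + 1 + h 0 - h (-1)) (h (-1)) *
    (Complex.sin ((Real.pi : ℂ) * x) / (Real.pi : ℂ))

end BarnesZeta4

end

/-!
The proof rests on Barnes' two lemmas and on the integral analogue of the very-well-poised `₅F₄`
sum.

Barnes' second lemma `barnes_second`, read from right to left, writes the well-poised quotient
`∏ Γ(h_j + t) / ∏ Γ(1 + h₀ - h_j + t)` over a triple of indices as an integral in `s` whose
integrand depends on `t` only through `Γ(t - s) / Γ(1 + h₀ + t + s)`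
(`Gamma_triple_quotient_eq`). Expanding both triples and integrating first over `t` leaves
a very-well-poised integral with two of the `h_j` equal to `-s` and `-w`, which has the closed form
`verticalIntegral_vwp_three`. This gives a double integral for arbitrary admissible parameters
(`vwpIntegral_six_eq`); when the differences of parameters are integers, the reflection formula
turns its kernels into those of the theorem (`gammaFactor_eq`, `gammaCoupling_eq`), and
for integer parameters the quotients of Gamma functions are Pochhammer symbols (`pochFactor_eq`).

The closed form is obtained by adding one parameter at a time. With one parameter
(`verticalIntegral_vwp_one`), Mellin inversion of the beta integral reduces it to an elementary
integral over `(0, 1)`. The second parameter comes from Barnes' second lemma with third parameter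
`1 / 2`, for which the corresponding quotient is `1` (`verticalIntegral_vwp_two`). The third one
comes from Barnes' first lemma, which expresses `Γ(A ± τ) Γ(B ± τ)` through `Γ(w ± τ)`
(`verticalIntegral_vwp_three`). At each step the inner integral is known and what remains is again
an integral of Barnes type.

All interchanges of integrals are justified by exponential bounds: on a vertical line `|Γ|` decays
faster than `exp (-3/2 |y|)` and `1 / |Γ|` grows slower than `exp (8/5 |y|)`. The predicate
`ExpBounded` records such bounds, so that integrability becomes a linear inequality between rates.
-/

namespace BarnesZeta4
open Complex Set Filter Topology

/-! ### The growth of the Gamma function on vertical lines -/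

theorem norm_betaIntegral_le {u v : ℂ} (hu : 0 < u.re) (hv : 0 < v.re) :
    ‖betaIntegral u v‖ ≤ ‖betaIntegral u.re v.re‖ := by
  have hconv := betaIntegral_convergent (u := (u.re : ℂ)) (v := (v.re : ℂ)) (by simpa) (by simpa)
  have h1 : betaIntegral u.re v.re =
      ((∫ x : ℝ in (0:ℝ)..1, x ^ (u.re - 1) * (1 - x) ^ (v.re - 1) : ℝ) : ℂ) := by
    rw [betaIntegral, ← intervalIntegral.integral_ofReal]
    refine intervalIntegral.integral_congr fun x hx => ?_
    rw [uIcc_of_le zero_le_one] at hx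
    simp only [ofReal_mul, ofReal_cpow hx.1, ofReal_cpow (sub_nonneg.2 hx.2)]
    push_cast
    rfl
  have hr : ∀ x ∈ Ioo (0:ℝ) 1, ‖(x : ℂ) ^ (u - 1) * (1 - (x : ℂ)) ^ (v - 1)‖ =
      x ^ (u.re - 1) * (1 - x) ^ (v.re - 1) := by
    intro x hx
    have : (1 - (x : ℂ)) = ((1 - x : ℝ) : ℂ) := by push_cast; rfl
    rw [norm_mul, this, norm_cpow_eq_rpow_re_of_pos hx.1,
      norm_cpow_eq_rpow_re_of_pos (sub_pos.2 hx.2)]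
    simp
  have h2 : ‖betaIntegral u v‖ ≤ ∫ x : ℝ in (0:ℝ)..1, x ^ (u.re - 1) * (1 - x) ^ (v.re - 1) := by
    rw [betaIntegral]
    refine (intervalIntegral.norm_integral_le_integral_norm zero_le_one).trans (le_of_eq ?_)
    rw [intervalIntegral.integral_of_le zero_le_one, intervalIntegral.integral_of_le zero_le_one,
      integral_Ioc_eq_integral_Ioo, integral_Ioc_eq_integral_Ioo]
    exact setIntegral_congr_fun measurableSet_Ioo hr
  refine h2.trans ?_
  rw [h1, norm_real, Real.norm_eq_abs]
  exact le_abs_self _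

/-- `‖Γ(x + iy)‖ / Γ(x)` is nondecreasing in `x > 0`: the ratio of its values at `x` and `x'` is
governed by the beta integral with parameters `x + iy` and `x' - x`. -/
theorem norm_Gamma_mul_le {z w : ℂ} (hz : 0 < z.re) (hzw : z.re ≤ w.re) (him : z.im = w.im) :
    ‖Gamma z‖ * Real.Gamma w.re ≤ ‖Gamma w‖ * Real.Gamma z.re := by
  rcases hzw.eq_or_lt with h | h
  · rw [Complex.ext h him]
  set d : ℝ := w.re - z.re with hd
  have hd0 : 0 < d := sub_pos.2 h
  have hw : w = z + d := by apply Complex.ext <;> simp [hd, him]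
  have hΓd : 0 < Real.Gamma d := Real.Gamma_pos_of_pos hd0
  have hΓw : 0 < Real.Gamma w.re := Real.Gamma_pos_of_pos (hz.trans h)
  have e1 := Gamma_mul_Gamma_eq_betaIntegral (s := z) (t := (d : ℂ)) hz (by simpa)
  have e2 := Gamma_mul_Gamma_eq_betaIntegral (s := (z.re : ℂ)) (t := (d : ℂ)) (by simpa) (by simpa)
  have hle := norm_betaIntegral_le (u := z) (v := (d : ℂ)) hz (by simpa)
  rw [ofReal_re] at hle
  rw [← hw, Gamma_ofReal] at e1
  rw [show (z.re : ℂ) + d = (w.re : ℂ) by rw [hd]; push_cast; ring, Gamma_ofReal, Gamma_ofReal,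
    Gamma_ofReal] at e2
  have n1 := congrArg norm e1
  have n2 := congrArg norm e2
  simp only [norm_mul, norm_real, Real.norm_eq_abs, abs_of_pos hΓd, abs_of_pos hΓw,
    abs_of_pos (Real.Gamma_pos_of_pos hz)] at n1 n2
  have hw0 := norm_nonneg (Gamma w)
  refine le_of_mul_le_mul_right ?_ hΓd
  calc ‖Gamma z‖ * Real.Gamma w.re * Real.Gamma d
      = ‖Gamma w‖ * ‖betaIntegral z d‖ * Real.Gamma w.re := by rw [← n1]; ring
    _ ≤ ‖Gamma w‖ * ‖betaIntegral z.re d‖ * Real.Gamma w.re := by gcongr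
    _ = ‖Gamma w‖ * Real.Gamma z.re * Real.Gamma d := by linear_combination (-‖Gamma w‖) * n2

/-- On the line `Re z = 1 / 2` the reflection formula gives `|Γ|` exactly, because there
`1 - z` is the conjugate of `z`. -/
theorem norm_Gamma_half_add_sq {z : ℂ} (hz : z.re = 1 / 2) :
    ‖Gamma z‖ ^ 2 = Real.pi / Real.cosh (Real.pi * z.im) := by
  have h1 : (1 : ℂ) - z = (starRingEnd ℂ) z := by
    apply Complex.ext <;> simp [hz]; norm_num
  have h2 := Complex.Gamma_mul_Gamma_one_sub z
  rw [h1, Complex.Gamma_conj, mul_conj] at h2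
  have h3 : Complex.sin (Real.pi * z) = ((Real.cosh (Real.pi * z.im) : ℝ) : ℂ) := by
    have : (Real.pi : ℂ) * z = (Real.pi / 2 : ℂ) + ((Real.pi * z.im : ℝ) : ℂ) * I := by
      apply Complex.ext <;> simp [hz]; ring
    rw [this, Complex.sin_add, Complex.sin_pi_div_two, Complex.cos_pi_div_two, Complex.cos_mul_I]
    push_cast; ring
  rw [h3, normSq_eq_norm_sq] at h2
  exact_mod_cast h2

theorem norm_Gamma_half_le {z : ℂ} (hz : z.re = 1 / 2) :
    ‖Gamma z‖ ≤ Real.sqrt (2 * Real.pi) * Real.exp (-(Real.pi / 2) * |z.im|) := by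
  refine le_of_sq_le_sq ?_ (by positivity)
  rw [norm_Gamma_half_add_sq hz, mul_pow, Real.sq_sqrt (by positivity), ← Real.exp_nat_mul,
    div_le_iff₀ (Real.cosh_pos _), ← Real.cosh_abs, abs_mul, abs_of_pos Real.pi_pos, Real.cosh_eq]
  have : Real.exp ((2:ℕ) * (-(Real.pi / 2) * |z.im|)) * Real.exp (Real.pi * |z.im|) = 1 := by
    rw [← Real.exp_add, Real.exp_eq_one_iff]; push_cast; ring
  have h2 := (Real.exp_pos ((2:ℕ) * (-(Real.pi / 2) * |z.im|)))
  have h3 := (Real.exp_pos (-(Real.pi * |z.im|)))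
  have h4 := mul_pos h2 h3
  nlinarith [Real.pi_pos]

theorem le_norm_Gamma_half {z : ℂ} (hz : z.re = 1 / 2) :
    Real.sqrt Real.pi * Real.exp (-(Real.pi / 2) * |z.im|) ≤ ‖Gamma z‖ := by
  refine le_of_sq_le_sq ?_ (norm_nonneg _)
  rw [norm_Gamma_half_add_sq hz, mul_pow, Real.sq_sqrt (by positivity), ← Real.exp_nat_mul,
    le_div_iff₀ (Real.cosh_pos _), ← Real.cosh_abs, abs_mul, abs_of_pos Real.pi_pos, Real.cosh_eq]
  have : Real.exp ((2:ℕ) * (-(Real.pi / 2) * |z.im|)) = Real.exp (-(Real.pi * |z.im|)) := by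
    congr 1; push_cast; ring
  have h1 : Real.exp (-(Real.pi * |z.im|)) * Real.exp (Real.pi * |z.im|) = 1 := by
    rw [← Real.exp_add]; simp
  have h2 : Real.exp (-(Real.pi * |z.im|)) ≤ 1 := Real.exp_le_one_iff.2 (by
    have := abs_nonneg z.im; have := Real.pi_pos; nlinarith [mul_nonneg this.le (abs_nonneg z.im)])
  have h3 := (Real.exp_pos (-(Real.pi * |z.im|)))
  rw [this]
  nlinarith [Real.pi_pos, mul_le_mul h2 h2 h3.le zero_le_one]

/-- On a vertical strip `‖z‖` is dominated by any growing exponential of `|Im z|`. -/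
theorem exists_norm_le_exp (R : ℝ) {ε : ℝ} (hε : 0 < ε) :
    ∃ C, 0 ≤ C ∧ ∀ z : ℂ, |z.re| ≤ R → ‖z‖ ≤ C * Real.exp (ε * |z.im|) := by
  refine ⟨|R| + 1 / ε, by positivity, fun z hz => ?_⟩
  have h1 := Complex.norm_le_abs_re_add_abs_im z
  have h2 := Real.add_one_le_exp (ε * |z.im|)
  have h3 : 1 ≤ Real.exp (ε * |z.im|) := Real.one_le_exp (by positivity)
  have h4 : |z.im| ≤ 1 / ε * Real.exp (ε * |z.im|) := by
    rw [div_mul_eq_mul_div, le_div_iff₀ hε]; linarith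
  have h5 : |R| * 1 ≤ |R| * Real.exp (ε * |z.im|) := by gcongr
  have := le_abs_self R
  rw [add_mul]; linarith

theorem exists_norm_Gamma_nat_add_half_le (n : ℕ) {a : ℝ} (ha : a < Real.pi / 2) :
    ∃ C, 0 ≤ C ∧ ∀ z : ℂ, z.re = n + 1 / 2 → ‖Gamma z‖ ≤ C * Real.exp (-a * |z.im|) := by
  induction n generalizing a with
  | zero =>
    refine ⟨_, by positivity, fun z hz => (norm_Gamma_half_le (by simpa using hz)).trans
      (mul_le_mul_of_nonneg_left (Real.exp_le_exp.2 ?_) (by positivity))⟩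
    nlinarith [abs_nonneg z.im]
  | succ n ih =>
    obtain ⟨b, hab, hb⟩ := exists_between ha
    obtain ⟨C, hC, h⟩ := ih hb
    obtain ⟨D, hD, h'⟩ := exists_norm_le_exp (n + 1 / 2) (sub_pos.2 hab)
    refine ⟨C * D, by positivity, fun z hz => ?_⟩
    push_cast at hz
    have hre : (z - 1).re = n + 1 / 2 := by simp [hz]; ring
    have hne : z - 1 ≠ 0 := fun h0 => by
      rw [h0] at hre; simp at hre; have : (0:ℝ) ≤ n := n.cast_nonneg; linarith
    have hz1 : Gamma z = (z - 1) * Gamma (z - 1) := by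
      rw [← Gamma_add_one _ hne]; simp
    have him : (z - 1).im = z.im := by simp
    have b1 := h _ hre
    have b2 := h' (z - 1) (by rw [hre, abs_of_nonneg]; positivity)
    rw [him] at b1 b2
    rw [hz1, norm_mul]
    calc _ ≤ (D * Real.exp ((b - a) * |z.im|)) * (C * Real.exp (-b * |z.im|)) := by gcongr
      _ = C * D * (Real.exp ((b - a) * |z.im|) * Real.exp (-b * |z.im|)) := by ring
      _ = _ := by rw [← Real.exp_add]; congr 2; ring

/-- On a strip in the right half-plane `|Γ|` decays at every exponential rate below `π / 2`: by
`norm_Gamma_mul_le` it is dominated by its values on a line `Re z = n + 1 / 2`. -/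
theorem exists_norm_Gamma_le {r : ℝ} (hr : 0 < r) (R : ℝ) {a : ℝ} (ha : a < Real.pi / 2) :
    ∃ C, 0 ≤ C ∧ ∀ z : ℂ, r ≤ z.re → z.re ≤ R → ‖Gamma z‖ ≤ C * Real.exp (-a * |z.im|) := by
  obtain ⟨n, hn⟩ := exists_nat_ge R
  obtain ⟨C, hC, h⟩ := exists_norm_Gamma_nat_add_half_le n ha
  have hcont : ContinuousOn Real.Gamma (Icc r R) := fun x hx =>
    (Real.differentiableAt_Gamma fun m => by
      have := hx.1; have : (0:ℝ) ≤ m := m.cast_nonneg; linarith).continuousAt.continuousWithinAt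
  obtain ⟨M, hM⟩ := (isCompact_Icc (a := r) (b := R)).exists_bound_of_continuousOn hcont
  have hG : 0 < Real.Gamma (n + 1 / 2) := Real.Gamma_pos_of_pos (by positivity)
  refine ⟨C * |M| / Real.Gamma (n + 1 / 2), by positivity, fun z h1 h2 => ?_⟩
  set w : ℂ := ⟨n + 1 / 2, z.im⟩ with hw
  have hle := norm_Gamma_mul_le (z := z) (w := w) (hr.trans_le h1)
    (by simp only [hw]; linarith) rfl
  have b1 := h w rfl
  have b2 := hM z.re ⟨h1, h2⟩
  have b3 := le_abs_self M
  rw [Real.norm_eq_abs, abs_of_pos (Real.Gamma_pos_of_pos (hr.trans_le h1))] at b2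
  rw [div_mul_eq_mul_div, le_div_iff₀ hG]
  calc _ ≤ ‖Gamma w‖ * Real.Gamma z.re := hle
    _ ≤ (C * Real.exp (-a * |w.im|)) * |M| := by
      gcongr
      · exact (Real.Gamma_pos_of_pos (hr.trans_le h1)).le
      · exact b2.trans b3
    _ = _ := by simp only [hw]; ring

/-- On any vertical strip `1 / |Γ|` grows at most at every exponential rate above `π / 2`. To the
right of `Re z = 1 / 2` this is `norm_Gamma_mul_le` against the line `Re z = 1 / 2`; the functional
equation then moves the left edge of the strip. -/
theorem exists_norm_inv_Gamma_le (r R : ℝ) {b : ℝ} (hb : Real.pi / 2 < b) :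
    ∃ C, 0 ≤ C ∧ ∀ z : ℂ, r ≤ z.re → z.re ≤ R → ‖(Gamma z)⁻¹‖ ≤ C * Real.exp (b * |z.im|) := by
  obtain ⟨n, hn⟩ := exists_nat_ge (1 / 2 - r)
  replace hn : 1 / 2 - n ≤ r := by linarith
  induction n generalizing r R b with
  | zero =>
    have hr : 0 < r := by simp at hn; linarith
    have hcont : ContinuousOn (fun x => (Real.Gamma x)⁻¹) (Icc r R) := fun x hx => by
      have hx0 := hr.trans_le hx.1
      exact ((Real.differentiableAt_Gamma fun m => by
        have : (0:ℝ) ≤ m := m.cast_nonneg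
        linarith).continuousAt.inv₀ (Real.Gamma_pos_of_pos hx0).ne').continuousWithinAt
    obtain ⟨M, hM⟩ := (isCompact_Icc (a := r) (b := R)).exists_bound_of_continuousOn hcont
    refine ⟨Real.Gamma (1 / 2) * |M| * (Real.sqrt Real.pi)⁻¹, ?_, fun z h1 h2 => ?_⟩
    · have := (Real.Gamma_pos_of_pos (s := 1 / 2) (by norm_num)).le
      positivity
    have hz0 := hr.trans_le h1
    have hΓz := Real.Gamma_pos_of_pos hz0
    have hΓh := Real.Gamma_pos_of_pos (s := 1 / 2) (by norm_num)
    set w : ℂ := ⟨1 / 2, z.im⟩ with hw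
    have hle := norm_Gamma_mul_le (z := w) (w := z) (by simp [hw])
      (by simp only [hw]; simp at hn; linarith) rfl
    have hlow := le_norm_Gamma_half (z := w) rfl
    have b2 := hM z.re ⟨h1, h2⟩
    rw [Real.norm_eq_abs, abs_of_pos (inv_pos.2 hΓz)] at b2
    have hnz : 0 < ‖Gamma z‖ := norm_pos_iff.2 (Gamma_ne_zero_of_re_pos hz0)
    have hE : 0 < Real.exp (-(Real.pi / 2) * |z.im|) := Real.exp_pos _
    have hs : 0 < Real.sqrt Real.pi := Real.sqrt_pos.2 Real.pi_pos
    have key : ‖Gamma z‖⁻¹ ≤ Real.Gamma (1 / 2) /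
        (Real.sqrt Real.pi * Real.exp (-(Real.pi / 2) * |z.im|) * Real.Gamma z.re) := by
      rw [inv_eq_one_div, div_le_div_iff₀ hnz (by positivity), one_mul, mul_comm (Real.Gamma _)]
      exact (mul_le_mul_of_nonneg_right hlow hΓz.le).trans hle
    rw [norm_inv]
    calc _ ≤ _ := key
      _ = Real.Gamma (1 / 2) * (Real.Gamma z.re)⁻¹ * (Real.sqrt Real.pi)⁻¹ *
          Real.exp (Real.pi / 2 * |z.im|) := by
        rw [neg_mul, Real.exp_neg]; field_simp
      _ ≤ Real.Gamma (1 / 2) * |M| * (Real.sqrt Real.pi)⁻¹ * Real.exp (b * |z.im|) := by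
        gcongr
        exact b2.trans (le_abs_self M)
  | succ n ih =>
    obtain ⟨a, ha, hab⟩ := exists_between hb
    obtain ⟨C, hC, h⟩ := ih (r + 1) (R + 1) ha (by push_cast at hn; linarith)
    obtain ⟨D, hD, h'⟩ := exists_norm_le_exp (max |r| |R|) (sub_pos.2 hab)
    refine ⟨D * C, by positivity, fun z h1 h2 => ?_⟩
    rcases eq_or_ne z 0 with rfl | hz
    · simp only [Gamma_zero, inv_zero, norm_zero]; positivity
    have e : (Gamma z)⁻¹ = z * (Gamma (z + 1))⁻¹ := by
      rw [Gamma_add_one _ hz, mul_inv, mul_inv_cancel_left₀ hz]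
    have b1 := h (z + 1) (by simpa using h1) (by simpa using h2)
    have b2 := h' z (abs_le_max_abs_abs h1 h2)
    rw [show (z + 1).im = z.im by simp] at b1
    rw [e, norm_mul]
    calc _ ≤ (D * Real.exp ((b - a) * |z.im|)) * (C * Real.exp (a * |z.im|)) := by gcongr
      _ = D * C * (Real.exp ((b - a) * |z.im|) * Real.exp (a * |z.im|)) := by ring
      _ = _ := by rw [← Real.exp_add]; congr 2; ring

/-! ### Functions dominated by an exponential -/

/-- `f` is continuous and `‖f‖` is at most a constant times `exp φ`. -/
def ExpBounded {X : Type*} [TopologicalSpace X] (f : X → ℂ) (φ : X → ℝ) : Prop :=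
  Continuous f ∧ ∃ C : ℝ, 0 ≤ C ∧ ∀ x, ‖f x‖ ≤ C * Real.exp (φ x)

section ExpBounded
variable {X : Type*} [TopologicalSpace X] {f g : X → ℂ} {φ ψ : X → ℝ}

theorem ExpBounded.mul (hf : ExpBounded f φ) (hg : ExpBounded g ψ) :
    ExpBounded (fun x => f x * g x) (fun x => φ x + ψ x) := by
  obtain ⟨hf, C, hC, h⟩ := hf
  obtain ⟨hg, D, hD, h'⟩ := hg
  refine ⟨hf.mul hg, C * D, by positivity, fun x => ?_⟩
  rw [norm_mul, Real.exp_add]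
  calc _ ≤ (C * Real.exp (φ x)) * (D * Real.exp (ψ x)) := by
        gcongr
        exacts [h x, h' x]
    _ = _ := by ring

theorem ExpBounded.div (hf : ExpBounded f φ) (hg : ExpBounded (fun x => (g x)⁻¹) ψ) :
    ExpBounded (fun x => f x / g x) (fun x => φ x + ψ x) := by
  simpa only [div_eq_mul_inv] using hf.mul hg

theorem ExpBounded.inv_mul (hf : ExpBounded (fun x => (f x)⁻¹) φ)
    (hg : ExpBounded (fun x => (g x)⁻¹) ψ) :
    ExpBounded (fun x => (f x * g x)⁻¹) (fun x => φ x + ψ x) := by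
  simpa only [mul_inv] using hf.mul hg

/-- The bounded discrepancy `D` is absorbed in the constant. -/
theorem ExpBounded.mono (hf : ExpBounded f φ) {D : ℝ} (h : ∀ x, φ x ≤ ψ x + D) :
    ExpBounded f ψ := by
  obtain ⟨hf, C, hC, h'⟩ := hf
  refine ⟨hf, C * Real.exp D, by positivity, fun x => (h' x).trans ?_⟩
  rw [mul_assoc, ← Real.exp_add, add_comm D]
  gcongr
  exact h x

theorem expBounded_const (k : ℂ) : ExpBounded (fun _ : X => k) (fun _ => 0) :=
  ⟨continuous_const, ‖k‖, norm_nonneg _, fun x => by simp⟩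

/-- Any rate below `π / 2` could replace `3 / 2`, and any rate above it could replace `8 / 5` in
`expBounded_inv_Gamma_strip`; these two leave enough room in every estimate below. -/
theorem expBounded_Gamma_strip {z : X → ℂ} (hz : Continuous z) {r R : ℝ} (hr : 0 < r)
    (h1 : ∀ x, r ≤ (z x).re) (h2 : ∀ x, (z x).re ≤ R) :
    ExpBounded (fun x => Gamma (z x)) (fun x => -(3 / 2) * |(z x).im|) := by
  obtain ⟨C, hC, h⟩ := exists_norm_Gamma_le hr R (a := 3 / 2) (by linarith [Real.pi_gt_d2])
  refine ⟨continuous_iff_continuousAt.2 fun x => ?_, C, hC, fun x => h _ (h1 x) (h2 x)⟩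
  refine ContinuousAt.comp (differentiableAt_Gamma _ fun m hm => ?_).continuousAt hz.continuousAt
  have h3 := hr.trans_le (h1 x)
  rw [hm] at h3
  simp at h3
  have : (0:ℝ) ≤ m := m.cast_nonneg
  linarith

theorem expBounded_inv_Gamma_strip {z : X → ℂ} (hz : Continuous z) {r R : ℝ}
    (h1 : ∀ x, r ≤ (z x).re) (h2 : ∀ x, (z x).re ≤ R) :
    ExpBounded (fun x => (Gamma (z x))⁻¹) (fun x => 8 / 5 * |(z x).im|) := by
  obtain ⟨C, hC, h⟩ := exists_norm_inv_Gamma_le r R (b := 8 / 5) (by linarith [Real.pi_lt_d2])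
  exact ⟨differentiable_one_div_Gamma.continuous.comp hz, C, hC, fun x => h _ (h1 x) (h2 x)⟩

theorem expBounded_Gamma {a : ℂ} (ha : 0 < a.re) {l : X → ℝ} (hl : Continuous l) {z : X → ℂ}
    (hz : ∀ x, z x = a + l x * I) :
    ExpBounded (fun x => Gamma (z x)) (fun x => -(3 / 2) * |l x|) := by
  obtain rfl : z = fun x => a + l x * I := funext hz
  refine (expBounded_Gamma_strip (by fun_prop) ha (fun x => by simp) (fun x => by simp; rfl)).mono
    (D := 3 / 2 * |a.im|) fun x => ?_
  have := abs_sub (a.im + l x) a.im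
  simp at this ⊢
  linarith

theorem expBounded_inv_Gamma (a : ℂ) {l : X → ℝ} (hl : Continuous l) {z : X → ℂ}
    (hz : ∀ x, z x = a + l x * I) :
    ExpBounded (fun x => (Gamma (z x))⁻¹) (fun x => 8 / 5 * |l x|) := by
  obtain rfl : z = fun x => a + l x * I := funext hz
  refine (expBounded_inv_Gamma_strip (r := a.re) (by fun_prop) (fun x => by simp)
    (fun x => by simp; rfl)).mono (D := 8 / 5 * |a.im|) fun x => ?_
  have := abs_add_le a.im (l x)
  simp at this ⊢
  linarith

theorem expBounded_linear {a b : ℂ} {l : X → ℝ} (hl : Continuous l) {z : X → ℂ}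
    (hz : ∀ x, z x = a + b * l x) : ExpBounded z (fun x => |l x|) := by
  obtain rfl : z = fun x => a + b * l x := funext hz
  refine ⟨by fun_prop, ‖a‖ + ‖b‖, by positivity, fun x => ?_⟩
  have h1 := Real.add_one_le_exp |l x|
  have h2 : 1 ≤ Real.exp |l x| := Real.one_le_exp (abs_nonneg _)
  calc _ ≤ ‖a‖ * 1 + ‖b‖ * |l x| := by
        refine (norm_add_le _ _).trans (le_of_eq ?_)
        rw [norm_mul, norm_real, Real.norm_eq_abs, mul_one]
    _ ≤ ‖a‖ * Real.exp |l x| + ‖b‖ * Real.exp |l x| := by gcongr; linarith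
    _ = _ := by ring

end ExpBounded

theorem integrable_exp_neg_mul_abs {δ : ℝ} (hδ : 0 < δ) :
    Integrable (fun y : ℝ => Real.exp (-δ * |y|)) := by
  rw [← integrableOn_univ, ← Iic_union_Ioi (a := (0:ℝ))]
  refine IntegrableOn.union ?_ ?_
  · refine (integrableOn_exp_mul_Iic hδ 0).congr_fun (fun y hy => ?_) measurableSet_Iic
    simp only [abs_of_nonpos (mem_Iic.1 hy), neg_mul_neg]
  · refine (integrableOn_exp_mul_Ioi (neg_neg_of_pos hδ) 0).congr_fun (fun y hy => ?_)
      measurableSet_Ioi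
    simp only [abs_of_pos (mem_Ioi.1 hy)]

theorem ExpBounded.integrable {f : ℝ → ℂ} {φ : ℝ → ℝ} (hf : ExpBounded f φ) {δ D : ℝ} (hδ : 0 < δ)
    (h : ∀ y, φ y ≤ -δ * |y| + D) : Integrable f := by
  obtain ⟨hc, C, hC, hb⟩ := hf.mono h
  exact ((integrable_exp_neg_mul_abs hδ).const_mul C).mono' hc.aestronglyMeasurable
    (Filter.Eventually.of_forall hb)

theorem ExpBounded.integrable_prod {f : ℝ × ℝ → ℂ} {φ : ℝ × ℝ → ℝ} (hf : ExpBounded f φ)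
    {δ D : ℝ} (hδ : 0 < δ) (h : ∀ p, φ p ≤ -δ * (|p.1| + |p.2|) + D) :
    Integrable f (volume.prod volume) := by
  obtain ⟨hc, C, hC, hb⟩ := hf.mono h
  refine (((integrable_exp_neg_mul_abs hδ).mul_prod
    (integrable_exp_neg_mul_abs hδ)).const_mul C).mono' hc.aestronglyMeasurable
    (Filter.Eventually.of_forall fun p => (hb p).trans (le_of_eq ?_))
  simp only [mul_add, Real.exp_add]

theorem ExpBounded.integrable_prod_prod {f : ℝ × ℝ × ℝ → ℂ} {φ : ℝ × ℝ × ℝ → ℝ}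
    (hf : ExpBounded f φ)
    {δ D : ℝ} (hδ : 0 < δ) (h : ∀ p, φ p ≤ -δ * (|p.1| + (|p.2.1| + |p.2.2|)) + D) :
    Integrable f (volume.prod (volume.prod volume)) := by
  obtain ⟨hc, C, hC, hb⟩ := hf.mono h
  refine (((integrable_exp_neg_mul_abs hδ).mul_prod ((integrable_exp_neg_mul_abs hδ).mul_prod
    (integrable_exp_neg_mul_abs hδ))).const_mul C).mono' hc.aestronglyMeasurable
    (Filter.Eventually.of_forall fun p => (hb p).trans (le_of_eq ?_))
  simp only [mul_add, Real.exp_add]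

/-! ### Vertical integrals -/

theorem verticalIntegral_eq (c : ℝ) (f : ℂ → ℂ) :
    verticalIntegral c f = (1 / (2 * Real.pi) : ℂ) * ∫ y : ℝ, f (c + y * I) := by
  rw [verticalIntegral, integral_mul_const]
  have : (Real.pi : ℂ) ≠ 0 := ofReal_ne_zero.2 Real.pi_ne_zero
  field_simp

theorem verticalIntegral_congr {c : ℝ} {f g : ℂ → ℂ} (h : ∀ z : ℂ, z.re = c → f z = g z) :
    verticalIntegral c f = verticalIntegral c g := by
  simp only [verticalIntegral]
  congr 2
  ext y
  rw [h _ (by simp)]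

theorem verticalIntegral_const_mul (c : ℝ) (k : ℂ) (f : ℂ → ℂ) :
    verticalIntegral c (fun z => k * f z) = k * verticalIntegral c f := by
  simp only [verticalIntegral_eq, integral_const_mul]
  ring

theorem verticalIntegral_sub {c : ℝ} {f g : ℂ → ℂ} (hf : VerticalIntegrable c f)
    (hg : VerticalIntegrable c g) :
    verticalIntegral c (fun z => f z - g z) = verticalIntegral c f - verticalIntegral c g := by
  simp only [verticalIntegral_eq]
  rw [integral_sub hf hg, mul_sub]

/-- The translation `z ↦ z + a` also absorbs the imaginary part of `a`. -/
theorem verticalIntegral_comp_add (c : ℝ) (a : ℂ) (f : ℂ → ℂ) :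
    verticalIntegral c (fun z => f (z + a)) = verticalIntegral (c + a.re) f := by
  simp only [verticalIntegral_eq]
  congr 1
  rw [← integral_add_right_eq_self _ (-a.im)]
  congr 1
  ext y
  congr 1
  apply Complex.ext <;> simp

theorem verticalIntegral_swap {c d : ℝ} {f : ℂ → ℂ → ℂ}
    (h : Integrable (fun p : ℝ × ℝ => f (c + p.1 * I) (d + p.2 * I)) (volume.prod volume)) :
    verticalIntegral c (fun s => verticalIntegral d (fun w => f s w)) =
      verticalIntegral d (fun w => verticalIntegral c (fun s => f s w)) := by
  simp only [verticalIntegral_eq, integral_const_mul]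
  rw [integral_integral_swap h]

theorem verticalIntegrable_Gamma_add_mul_Gamma_sub {a c : ℂ} {σ : ℝ} (ha : 0 < (a + σ).re)
    (hc : 0 < (c - σ).re) : VerticalIntegrable σ (fun s => Gamma (a + s) * Gamma (c - s)) := by
  refine ExpBounded.integrable (.mul (expBounded_Gamma (a := a + σ) (l := fun y => y) ha
      continuous_id (fun y => by ring)) (expBounded_Gamma (a := c - σ) (l := fun y => -y) hc
      continuous_neg (fun y => by push_cast; ring))) (δ := 1) (D := 0) one_pos
      (fun y => ?_)
  simp only [abs_neg]
  linarith [abs_nonneg y]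

/-- Interchange of a vertical integral with an integral against `x ^ s`, for `x` in a subset of
the positive half-line. -/
theorem verticalIntegral_mul_setIntegral_cpow {σ : ℝ} {G : ℂ → ℂ} {g : ℝ → ℂ} {S : Set ℝ}
    (hS : MeasurableSet S) (hpos : S ⊆ Ioi 0) (hG : VerticalIntegrable σ G)
    (hg : IntegrableOn (fun x : ℝ => (x : ℂ) ^ (σ : ℂ) * g x) S) :
    verticalIntegral σ (fun s => G s * ∫ x in S, (x : ℂ) ^ s * g x) =
      ∫ x in S, g x * verticalIntegral σ (fun s => G s * (x : ℂ) ^ s) := by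
  have key : Integrable (fun p : ℝ × ℝ =>
      G (σ + p.1 * I) * ((p.2 : ℂ) ^ (σ + p.1 * I : ℂ) * g p.2))
      (volume.prod (volume.restrict S)) := by
    have h1 : Integrable (fun p : ℝ × ℝ =>
        G (σ + p.1 * I) * ((p.2 : ℂ) ^ (σ : ℂ) * g p.2)) (volume.prod (volume.restrict S)) :=
      Integrable.mul_prod (μ := volume) (f := fun y : ℝ => G (σ + y * I)) hG hg
    have h2 : Measurable fun p : ℝ × ℝ => (p.2 : ℂ) ^ (p.1 * I : ℂ) := by fun_prop
    have hae : ∀ᵐ p : ℝ × ℝ ∂(volume.prod (volume.restrict S)), 0 < p.2 := by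
      have : ∀ᵐ x ∂(volume.restrict S), 0 < x :=
        (ae_restrict_mem hS).mono fun x hx => hpos hx
      exact Measure.quasiMeasurePreserving_snd.ae this
    have h3 := h1.mul_of_top_left (f := fun p : ℝ × ℝ => (p.2 : ℂ) ^ (p.1 * I : ℂ))
      (memLp_top_of_bound h2.aestronglyMeasurable 1 (hae.mono fun p hp => by
        rw [norm_cpow_eq_rpow_re_of_pos hp]; simp))
    refine h3.congr (hae.mono fun p hp => ?_)
    have : (p.2 : ℂ) ≠ 0 := ofReal_ne_zero.2 hp.ne'
    simp only [Pi.mul_apply, cpow_add _ _ this]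
    ring
  simp only [verticalIntegral_eq, ← integral_const_mul]
  have hsw := integral_integral_swap
    (f := fun y x : ℝ => G (σ + y * I) * ((x : ℂ) ^ (σ + y * I : ℂ) * g x)) key
  simp only [integral_const_mul] at hsw ⊢
  rw [hsw, ← integral_const_mul]
  congr 1
  ext x
  rw [← integral_const_mul, ← integral_const_mul, ← integral_const_mul]
  congr 1
  ext y
  ring

/-! ### The beta integral on the half-line and its Mellin inverse -/

theorem integrableOn_and_integral_cpow_mul_one_add_cpow {a c : ℂ} (ha : 0 < a.re) (hc : 0 < c.re) :
    IntegrableOn (fun x : ℝ => (x : ℂ) ^ (a - 1) * (1 + x : ℂ) ^ (-(a + c))) (Ioi 0) ∧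
    ∫ x : ℝ in Ioi 0, (x : ℂ) ^ (a - 1) * (1 + x : ℂ) ^ (-(a + c)) =
      Gamma a * Gamma c / Gamma (a + c) := by
  have himg : (fun u : ℝ => u / (1 - u)) '' Ioo 0 1 = Ioi 0 := by
    ext x
    constructor
    · rintro ⟨u, hu, rfl⟩
      exact div_pos hu.1 (sub_pos.2 hu.2)
    · intro hx
      have hx : 0 < x := hx
      refine ⟨x / (1 + x), ⟨by positivity, by rw [div_lt_one (by positivity)]; linarith⟩, ?_⟩
      simp only
      field_simp
      ring
  have hder : ∀ u ∈ Ioo (0:ℝ) 1,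
      HasDerivWithinAt (fun u : ℝ => u / (1 - u)) (1 / (1 - u) ^ 2) (Ioo 0 1) u := by
    intro u hu
    have h := ((hasDerivAt_id u).div ((hasDerivAt_id u).const_sub 1)
      (sub_pos.2 hu.2).ne').hasDerivWithinAt (s := Ioo 0 1)
    refine h.congr_deriv ?_
    simp
  have hinj : InjOn (fun u : ℝ => u / (1 - u)) (Ioo 0 1) := by
    intro u hu v hv h
    have h1 := (sub_pos.2 hu.2).ne'
    have h2 := (sub_pos.2 hv.2).ne'
    simp only at h
    rw [div_eq_div_iff h1 h2] at h
    linarith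
  have hfun : ∀ u ∈ Ioo (0:ℝ) 1, |1 / (1 - u) ^ 2| • (((u / (1 - u) : ℝ) : ℂ) ^ (a - 1) *
      (1 + ((u / (1 - u) : ℝ) : ℂ)) ^ (-(a + c))) = (u : ℂ) ^ (a - 1) * (1 - u : ℂ) ^ (c - 1) := by
    intro u hu
    have h1 := sub_pos.2 hu.2
    have e1 : (1 + ((u / (1 - u) : ℝ) : ℂ)) = (((1 - u)⁻¹ : ℝ) : ℂ) := by
      rw [← ofReal_one, ← ofReal_add]; congr 1; field_simp; ring
    have e2 : (1 - u : ℂ) = ((1 - u : ℝ) : ℂ) := by push_cast; rfl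
    have hne : ((1 - u : ℝ) : ℂ) ≠ 0 := ofReal_ne_zero.2 h1.ne'
    have harg : ((1 - u : ℝ) : ℂ).arg ≠ Real.pi := by
      rw [arg_ofReal_of_nonneg h1.le]; exact Real.pi_ne_zero.symm
    rw [e1, e2, abs_of_pos (by positivity), real_smul, div_eq_mul_inv u,
      ofReal_mul, mul_cpow_ofReal_nonneg hu.1.le (inv_pos.2 h1).le, ofReal_inv,
      inv_cpow _ _ harg, inv_cpow _ _ harg, ← cpow_neg, ← cpow_neg, neg_neg, one_div,
      ofReal_inv, ofReal_pow, ← cpow_natCast, ← cpow_neg]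
    have : ((1 - u : ℝ) : ℂ) ^ (c - 1) = ((1 - u : ℝ) : ℂ) ^ (-((2:ℕ) : ℂ)) *
        ((1 - u : ℝ) : ℂ) ^ (-(a - 1)) * ((1 - u : ℝ) : ℂ) ^ (a + c) := by
      rw [← cpow_add _ _ hne, ← cpow_add _ _ hne]; congr 1; push_cast; ring
    rw [this]; ring
  have hbeta := betaIntegral_convergent ha hc
  rw [intervalIntegrable_iff_integrableOn_Ioo_of_le zero_le_one] at hbeta
  constructor
  · rw [← himg, integrableOn_image_iff_integrableOn_abs_deriv_smul measurableSet_Ioo hder hinj]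
    exact hbeta.congr_fun (fun u hu => (hfun u hu).symm) measurableSet_Ioo
  · rw [← himg, integral_image_eq_integral_abs_deriv_smul measurableSet_Ioo hder hinj,
      setIntegral_congr_fun measurableSet_Ioo hfun, Gamma_mul_Gamma_eq_betaIntegral ha hc,
      mul_div_cancel_left₀ _ (Gamma_ne_zero_of_re_pos (by simp; linarith)), betaIntegral,
      intervalIntegral.integral_of_le zero_le_one, integral_Ioc_eq_integral_Ioo]

/-- Mellin inversion of the beta integral. -/
theorem verticalIntegral_Gamma_mul_Gamma_mul_cpow {a c : ℂ} {σ : ℝ} (ha : 0 < (a + σ).re)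
    (hc : 0 < (c - σ).re) {x : ℝ} (hx : 0 < x) :
    verticalIntegral σ (fun s => Gamma (a + s) * Gamma (c - s) * (x : ℂ) ^ s) =
      Gamma (a + c) * ((x : ℂ) ^ c * (1 + x : ℂ) ^ (-(a + c))) := by
  set f : ℝ → ℂ := fun x => (x : ℂ) ^ a * (1 + x : ℂ) ^ (-(a + c)) with hf
  have hne : Gamma (a + c) ≠ 0 := Gamma_ne_zero_of_re_pos (by simp at ha hc ⊢; linarith)
  have hfun : ∀ s : ℂ, ∀ t ∈ Ioi (0:ℝ), (t : ℂ) ^ (a + s - 1) * (1 + t : ℂ) ^ (-(a + s + (c - s))) =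
      (t : ℂ) ^ (s - 1) • f t := by
    intro s t ht
    have : (t : ℂ) ≠ 0 := ofReal_ne_zero.2 (ne_of_gt ht)
    rw [hf, show a + s - 1 = (s - 1) + a by ring, cpow_add _ _ this, smul_eq_mul,
      show a + s + (c - s) = a + c by ring, mul_assoc]
  have hline : ∀ s : ℂ, s.re = σ → MellinConvergent f s ∧
      mellin f s = Gamma (a + s) * Gamma (c - s) / Gamma (a + c) := by
    intro s hs
    obtain ⟨h1, h2⟩ := integrableOn_and_integral_cpow_mul_one_add_cpow (a := a + s) (c := c - s)
      (by simpa [hs] using ha) (by simpa [hs] using hc)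
    refine ⟨h1.congr_fun (hfun s) measurableSet_Ioi, ?_⟩
    rw [mellin, ← setIntegral_congr_fun measurableSet_Ioi (hfun s), h2]
    congr 2; ring
  have hint := verticalIntegrable_Gamma_add_mul_Gamma_sub ha hc
  have hcont : ContinuousAt f x⁻¹ := by
    have hp : (0:ℝ) < x⁻¹ := by positivity
    refine ContinuousAt.mul ?_ ?_
    · exact continuous_ofReal.continuousAt.cpow continuousAt_const (ofReal_mem_slitPlane.2 hp)
    · refine ContinuousAt.cpow (by fun_prop) continuousAt_const ?_
      rw [← ofReal_one, ← ofReal_add]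
      exact ofReal_mem_slitPlane.2 (by positivity)
  have hinv := mellinInv_mellin_eq σ f (x := x⁻¹) (by positivity) (hline σ (by simp)).1 (by
    refine (hint.div_const (Gamma (a + c))).congr (Filter.Eventually.of_forall fun y => ?_)
    exact (hline _ (by simp)).2.symm) hcont
  have hx0 : (x : ℂ) ≠ 0 := ofReal_ne_zero.2 hx.ne'
  have harg : (x : ℂ).arg ≠ Real.pi := by
    rw [arg_ofReal_of_nonneg hx.le]; exact Real.pi_ne_zero.symm
  have harg' : ((1 + x : ℝ) : ℂ).arg ≠ Real.pi := by
    rw [arg_ofReal_of_nonneg (by positivity)]; exact Real.pi_ne_zero.symm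
  have hfx : f x⁻¹ = (x : ℂ) ^ c * (1 + x : ℂ) ^ (-(a + c)) := by
    have e : (1 + (x⁻¹ : ℝ) : ℂ) = ((1 + x : ℝ) : ℂ) * ((x⁻¹ : ℝ) : ℂ) := by
      push_cast; field_simp; ring
    simp only [hf]
    rw [e, mul_cpow_ofReal_nonneg (by positivity) (by positivity), ofReal_inv,
      inv_cpow _ _ harg, inv_cpow _ _ harg, ← cpow_neg, ← cpow_neg, neg_neg]
    have : (x : ℂ) ^ c = (x : ℂ) ^ (-a) * (x : ℂ) ^ (a + c) := by
      rw [← cpow_add _ _ hx0]; congr 1; ring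
    rw [this]
    push_cast
    ring
  rw [hfx] at hinv
  rw [← hinv, verticalIntegral_eq, mellinInv, real_smul, mul_left_comm,
    ← integral_const_mul (Gamma (a + c))]
  push_cast
  congr 1
  refine integral_congr_ae (Filter.Eventually.of_forall fun y => ?_)
  simp only
  rw [(hline _ (by simp)).2, inv_cpow _ _ harg, cpow_neg, inv_inv, smul_eq_mul]
  field_simp

/-! ### Barnes' lemmas -/

/-- Barnes' first lemma. -/
theorem barnes_first {a b c d : ℂ} {σ : ℝ} (ha : 0 < (a + σ).re) (hb : 0 < (b + σ).re)
    (hc : 0 < (c - σ).re) (hd : 0 < (d - σ).re) :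
    verticalIntegral σ (fun s => Gamma (a + s) * Gamma (b + s) * Gamma (c - s) * Gamma (d - s)) =
      Gamma (a + c) * Gamma (a + d) * Gamma (b + c) * Gamma (b + d) / Gamma (a + b + c + d) := by
  simp only [add_re, sub_re, ofReal_re] at ha hb hc hd
  have hbd : Gamma (b + d) ≠ 0 := Gamma_ne_zero_of_re_pos (by simp; linarith)
  have hfun : ∀ s : ℂ, ∀ x ∈ Ioi (0:ℝ), (x : ℂ) ^ (b + s - 1) *
      (1 + x : ℂ) ^ (-(b + s + (d - s))) =
      (x : ℂ) ^ s * ((x : ℂ) ^ (b - 1) * (1 + x : ℂ) ^ (-(b + d))) := by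
    intro s x hx
    have : (x : ℂ) ≠ 0 := ofReal_ne_zero.2 (ne_of_gt hx)
    rw [show b + s - 1 = s + (b - 1) by ring, cpow_add _ _ this,
      show b + s + (d - s) = b + d by ring, mul_assoc]
  have hline : ∀ s : ℂ, s.re = σ → IntegrableOn (fun x : ℝ => (x : ℂ) ^ s *
      ((x : ℂ) ^ (b - 1) * (1 + x : ℂ) ^ (-(b + d)))) (Ioi 0) ∧
      ∫ x : ℝ in Ioi 0, (x : ℂ) ^ s * ((x : ℂ) ^ (b - 1) * (1 + x : ℂ) ^ (-(b + d))) =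
        Gamma (b + s) * Gamma (d - s) / Gamma (b + d) := by
    intro s hs
    obtain ⟨h1, h2⟩ := integrableOn_and_integral_cpow_mul_one_add_cpow (a := b + s) (c := d - s)
      (by simpa [hs] using hb) (by simpa [hs] using hd)
    refine ⟨h1.congr_fun (hfun s) measurableSet_Ioi, ?_⟩
    rw [← setIntegral_congr_fun measurableSet_Ioi (hfun s), h2]
    congr 2; ring
  have hint := verticalIntegrable_Gamma_add_mul_Gamma_sub (a := a) (c := c) (σ := σ)
    (by simpa using ha) (by simpa using hc)
  calc _ = verticalIntegral σ (fun s => Gamma (b + d) * ((Gamma (a + s) * Gamma (c - s)) *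
        ∫ x : ℝ in Ioi 0, (x : ℂ) ^ s * ((x : ℂ) ^ (b - 1) * (1 + x : ℂ) ^ (-(b + d))))) := by
        refine verticalIntegral_congr fun s hs => ?_
        rw [(hline s hs).2]; field_simp
    _ = Gamma (b + d) * ∫ x : ℝ in Ioi 0, Gamma (a + c) * ((x : ℂ) ^ (b + c - 1) *
        (1 + x : ℂ) ^ (-(b + c + (a + d)))) := by
        rw [verticalIntegral_const_mul, verticalIntegral_mul_setIntegral_cpow measurableSet_Ioi
          subset_rfl hint (hline σ (by simp)).1]
        congr 1
        refine setIntegral_congr_fun measurableSet_Ioi fun x hx => ?_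
        have hx : 0 < x := hx
        have h0 : (x : ℂ) ≠ 0 := ofReal_ne_zero.2 hx.ne'
        have h1 : (1 + x : ℂ) ≠ 0 := by
          rw [← ofReal_one, ← ofReal_add]; exact ofReal_ne_zero.2 (by positivity)
        rw [verticalIntegral_Gamma_mul_Gamma_mul_cpow (by simpa) (by simpa using hc) hx,
          show b + c - 1 = (b - 1) + c by ring, cpow_add _ _ h0,
          show -(b + c + (a + d)) = -(b + d) + -(a + c) by ring, cpow_add _ _ h1]
        ring
    _ = _ := by
        rw [integral_const_mul, (integrableOn_and_integral_cpow_mul_one_add_cpow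
          (a := b + c) (c := a + d) (by simp; linarith) (by simp; linarith)).2,
          show b + c + (a + d) = a + b + c + d by ring]
        ring

/-- Barnes' second lemma. It follows from the first one, applied three times, by expanding
`Γ(a + s) Γ(c + s) / Γ(a + b + c + d + e + s)` as an integral. -/
theorem barnes_second {a b c d e : ℂ} {σ : ℝ} (ha : 0 < (a + σ).re) (hb : 0 < (b + σ).re)
    (hc : 0 < (c + σ).re) (hd : 0 < (d - σ).re) (he : 0 < (e - σ).re) :
    verticalIntegral σ (fun s => Gamma (a + s) * Gamma (b + s) * Gamma (c + s) *
        Gamma (d - s) * Gamma (e - s) / Gamma (a + b + c + d + e + s)) =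
      Gamma (a + d) * Gamma (b + d) * Gamma (c + d) * Gamma (a + e) * Gamma (b + e) *
        Gamma (c + e) /
        (Gamma (a + b + d + e) * Gamma (a + c + d + e) * Gamma (b + c + d + e)) := by
  simp only [add_re, sub_re, ofReal_re] at ha hb hc hd he
  obtain ⟨ρ, h1, h2⟩ := exists_between (show -σ < min a.re c.re from
    lt_min (by linarith) (by linarith))
  obtain ⟨h2, h3⟩ := lt_min_iff.1 h2
  have n1 : Gamma (a + b + d + e) ≠ 0 := Gamma_ne_zero_of_re_pos (by simp; linarith)
  have n2 : Gamma (b + c + d + e) ≠ 0 := Gamma_ne_zero_of_re_pos (by simp; linarith)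
  have hw : ∀ w : ℂ, w.re = ρ → verticalIntegral σ (fun s => Gamma (b + s) * Gamma (d - s) *
      Gamma (e - s) * (Gamma (s + w) * Gamma (b + d + e + w) * Gamma (a - w) * Gamma (c - w))) =
      Gamma (b + d) * Gamma (b + e) *
        (Gamma (d + w) * Gamma (e + w) * Gamma (a - w) * Gamma (c - w)) := by
    intro w hw
    have n3 : Gamma (b + d + e + w) ≠ 0 := Gamma_ne_zero_of_re_pos (by simp; linarith)
    have hI := barnes_first (a := w) (b := b) (c := d) (d := e) (σ := σ) (by simp; linarith)
      (by simp; linarith) (by simp; linarith) (by simp; linarith)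
    rw [show (fun s => Gamma (b + s) * Gamma (d - s) *
      Gamma (e - s) * (Gamma (s + w) * Gamma (b + d + e + w) * Gamma (a - w) * Gamma (c - w))) =
      fun s => (Gamma (b + d + e + w) * Gamma (a - w) * Gamma (c - w)) *
        (Gamma (w + s) * Gamma (b + s) * Gamma (d - s) * Gamma (e - s)) by
        ext s; rw [add_comm w]; ring, verticalIntegral_const_mul, hI,
        show w + b + d + e = b + d + e + w by ring, add_comm w, add_comm w]
    field_simp
  calc _ = verticalIntegral σ (fun s => (Gamma (a + b + d + e) * Gamma (b + c + d + e))⁻¹ *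
        verticalIntegral ρ (fun w => Gamma (b + s) * Gamma (d - s) *
          Gamma (e - s) *
          (Gamma (s + w) * Gamma (b + d + e + w) * Gamma (a - w) * Gamma (c - w)))) := by
        refine verticalIntegral_congr fun s hs => ?_
        rw [verticalIntegral_const_mul, barnes_first (by simp; linarith)
          (by simp; linarith) (by simp; linarith) (by simp; linarith),
          show b + d + e + a = a + b + d + e by ring, show b + d + e + c = b + c + d + e by ring,
          show s + (b + d + e) + a + c = a + b + c + d + e + s by ring, add_comm s, add_comm s]
        field_simp
    _ = (Gamma (a + b + d + e) * Gamma (b + c + d + e))⁻¹ * verticalIntegral ρ (fun w =>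
        Gamma (b + d) * Gamma (b + e) *
          (Gamma (d + w) * Gamma (e + w) * Gamma (a - w) * Gamma (c - w))) := by
        rw [verticalIntegral_const_mul, verticalIntegral_swap]
        · rw [verticalIntegral_congr hw]
        · refine ExpBounded.integrable_prod (.mul
            (.mul (.mul
              (expBounded_Gamma (a := b + σ) (l := fun p => p.1) ?_ (by fun_prop)
                fun p => by ring)
              (expBounded_Gamma (a := d - σ) (l := fun p => -p.1) ?_ (by fun_prop)
                fun p => by push_cast; ring))
              (expBounded_Gamma (a := e - σ) (l := fun p => -p.1) ?_ (by fun_prop)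
                fun p => by push_cast; ring))
            (.mul (.mul (.mul
              (expBounded_Gamma (a := σ + ρ) (l := fun p => p.1 + p.2) ?_ (by fun_prop)
                fun p => by push_cast; ring)
              (expBounded_Gamma (a := b + d + e + ρ) (l := fun p => p.2) ?_ (by fun_prop)
                fun p => by ring))
              (expBounded_Gamma (a := a - ρ) (l := fun p => -p.2) ?_ (by fun_prop)
                fun p => by push_cast; ring))
              (expBounded_Gamma (a := c - ρ) (l := fun p => -p.2) ?_ (by fun_prop)
                fun p => by push_cast; ring))) (δ := 1) (D := 0) one_pos ?_
          case refine_8 =>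
            intro p
            simp only [abs_neg]
            linarith [abs_nonneg p.1, abs_nonneg p.2, abs_nonneg (p.1 + p.2)]
          all_goals simp
          all_goals linarith
    _ = _ := by
        rw [verticalIntegral_const_mul, barnes_first (by simp; linarith)
          (by simp; linarith) (by simp; linarith) (by simp; linarith),
          show d + e + a + c = a + c + d + e by ring, add_comm d, add_comm d, add_comm e,
          add_comm e]
        field_simp

/-- Euler's integral for a quotient of Gamma functions. -/
theorem setIntegral_Ioo_cpow_mul_one_sub_cpow {a b : ℂ} (ha : 0 < a.re) (hb : 0 < b.re) :
    IntegrableOn (fun x : ℝ => (x : ℂ) ^ (a - 1) * (1 - x : ℂ) ^ (b - 1)) (Ioo 0 1) ∧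
    ∫ x : ℝ in Ioo 0 1, (x : ℂ) ^ (a - 1) * (1 - x : ℂ) ^ (b - 1) =
      Gamma a * Gamma b / Gamma (a + b) := by
  have hbeta := betaIntegral_convergent ha hb
  rw [intervalIntegrable_iff_integrableOn_Ioo_of_le zero_le_one] at hbeta
  refine ⟨hbeta, ?_⟩
  rw [Gamma_mul_Gamma_eq_betaIntegral ha hb,
      mul_div_cancel_left₀ _ (Gamma_ne_zero_of_re_pos (by simp; linarith)), betaIntegral,
      intervalIntegral.integral_of_le zero_le_one, integral_Ioc_eq_integral_Ioo]

/-- The substitution `y = ((1 - x) / (1 + x)) ^ 2` turns this integral into a beta integral. -/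
theorem setIntegral_cpow_mul_one_sub_cpow_mul_one_add_cpow {A u : ℂ} (hu : 0 < (1 + u).re)
    (hA : 0 < (A - u).re) :
    ∫ x : ℝ in Ioo 0 1, (x : ℂ) ^ (A - u - 1) * (1 - x : ℂ) ^ (2 * u + 1) *
      (1 + x : ℂ) ^ (-(2 * A + 1)) =
      (2 : ℂ) ^ (2 * u - 2 * A) * (Gamma (1 + u) * Gamma (A - u) / Gamma (1 + A)) := by
  set f : ℝ → ℝ := fun x => ((1 - x) / (1 + x)) ^ 2 with hf
  have himg : f '' Ioo 0 1 = Ioo 0 1 := by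
    ext y
    constructor
    · rintro ⟨x, hx, rfl⟩
      have h1 := sub_pos.2 hx.2
      have h2 := hx.1
      refine ⟨by positivity, ?_⟩
      rw [hf, sq_lt_one_iff₀ (by positivity), div_lt_one (by positivity)]
      linarith
    · intro hy
      have hs : 0 < Real.sqrt y := Real.sqrt_pos.2 hy.1
      have hs1 : Real.sqrt y < 1 := by
        rw [Real.sqrt_lt' one_pos]; simpa using hy.2
      have h1 := sub_pos.2 hs1
      refine ⟨(1 - Real.sqrt y) / (1 + Real.sqrt y), ⟨by positivity, ?_⟩, ?_⟩
      · rw [div_lt_one (by positivity)]; linarith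
      · have : (1 - (1 - Real.sqrt y) / (1 + Real.sqrt y)) /
            (1 + (1 - Real.sqrt y) / (1 + Real.sqrt y)) = Real.sqrt y := by
          field_simp; ring
        simp only [hf, this]
        exact Real.sq_sqrt hy.1.le
  have hder : ∀ x ∈ Ioo (0:ℝ) 1,
      HasDerivWithinAt f (-(4 * (1 - x) / (1 + x) ^ 3)) (Ioo 0 1) x := by
    intro x hx
    have h2 : (1 + x) ≠ 0 := by have := hx.1; positivity
    have h := ((((hasDerivAt_id x).const_sub 1).div ((hasDerivAt_id x).const_add 1)
      h2).pow 2).hasDerivWithinAt (s := Ioo 0 1)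
    refine h.congr_deriv ?_
    simp
    field_simp
    ring
  have hinj : InjOn f (Ioo 0 1) := by
    intro x hx y hy h
    have h1 : (0:ℝ) < 1 + x := by have := hx.1; positivity
    have h2 : (0:ℝ) < 1 + y := by have := hy.1; positivity
    have h3 := (div_pos (sub_pos.2 hx.2) h1).le
    have h4 := (div_pos (sub_pos.2 hy.2) h2).le
    have h5 := (sq_eq_sq₀ h3 h4).1 h
    rw [div_eq_div_iff h1.ne' h2.ne'] at h5
    linarith
  have hfun : ∀ x ∈ Ioo (0:ℝ) 1, |-(4 * (1 - x) / (1 + x) ^ 3)| •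
      (((f x : ℝ) : ℂ) ^ (1 + u - 1) * (1 - (f x : ℝ) : ℂ) ^ (A - u - 1)) =
      (2 : ℂ) ^ (2 * A - 2 * u) * ((x : ℂ) ^ (A - u - 1) * (1 - x : ℂ) ^ (2 * u + 1) *
      (1 + x : ℂ) ^ (-(2 * A + 1))) := by
    intro x hx
    have h0 := hx.1
    have h1 := sub_pos.2 hx.2
    have h2 : (0:ℝ) < 1 + x := by have := hx.1; positivity
    have e1 : ((f x : ℝ) : ℂ) = exp (((2 * (Real.log (1 - x) - Real.log (1 + x)) : ℝ))) := by
      rw [← ofReal_exp]; congr 1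
      rw [two_mul, Real.exp_add, Real.exp_sub, Real.exp_log h1, Real.exp_log h2]
      simp only [hf]; ring
    have e2 : (1 - (f x : ℝ) : ℂ) =
        exp (((2 * Real.log 2 + Real.log x - 2 * Real.log (1 + x) : ℝ))) := by
      rw [← ofReal_exp, ← ofReal_one, ← ofReal_sub]; congr 1
      rw [two_mul, two_mul, Real.exp_sub, Real.exp_add, Real.exp_add, Real.exp_add,
        Real.exp_log h2, Real.exp_log h0, Real.exp_log two_pos]
      simp only [hf]; field_simp; ring
    have e3 : ∀ t : ℝ, 0 < t → ∀ z : ℂ, (t : ℂ) ^ z = exp (Real.log t * z) := by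
      intro t ht z
      rw [cpow_def_of_ne_zero (ofReal_ne_zero.2 ht.ne'), ofReal_log ht.le]
    have e4 : ∀ t : ℝ, ∀ z : ℂ, (exp (t : ℂ)) ^ z = exp (t * z) := by
      intro t z
      rw [cpow_def_of_ne_zero (exp_ne_zero _), ← ofReal_exp, ← ofReal_log (Real.exp_pos _).le,
        Real.log_exp]
    have e5 : ((4 * (1 - x) / (1 + x) ^ 3 : ℝ) : ℂ) =
        exp (((2 * Real.log 2 + Real.log (1 - x) - 3 * Real.log (1 + x) : ℝ))) := by
      rw [← ofReal_exp]; congr 1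
      rw [Real.exp_sub, Real.exp_add, show (3:ℝ) = ((3:ℕ):ℝ) by norm_num, Real.exp_nat_mul,
        show (2:ℝ) * Real.log 2 = ((2:ℕ):ℝ) * Real.log 2 by norm_num, Real.exp_nat_mul,
        Real.exp_log h2, Real.exp_log h1, Real.exp_log two_pos]
      norm_num
    rw [abs_neg, abs_of_pos (by positivity), real_smul, e5, e2, e1, e4, e4,
      show (1 - x : ℂ) = ((1 - x : ℝ) : ℂ) by push_cast; rfl,
      show (1 + x : ℂ) = ((1 + x : ℝ) : ℂ) by push_cast; rfl,
      show (2 : ℂ) = ((2 : ℝ) : ℂ) by norm_num, e3 _ two_pos, e3 _ h0, e3 _ h1, e3 _ h2]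
    simp only [← exp_add]
    congr 1
    push_cast
    ring
  have hI := (setIntegral_Ioo_cpow_mul_one_sub_cpow (a := 1 + u) (b := A - u) hu hA).2
  rw [← himg, integral_image_eq_integral_abs_deriv_smul measurableSet_Ioo hder hinj,
      setIntegral_congr_fun measurableSet_Ioo hfun, integral_const_mul,
      show 1 + u + (A - u) = 1 + A by ring] at hI
  rw [← hI, ← mul_assoc, ← cpow_add _ _ two_ne_zero]
  simp

/-! ### Very-well-poised integrals -/

/-- The factor `2 τ = (A + τ) - (A - τ)` splits the very-well-poised integrand
into a difference of two beta integrals. -/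
theorem two_mul_mul_Gamma_mul_Gamma {A τ : ℂ} (h1 : A + τ ≠ 0) (h2 : A - τ ≠ 0) :
    2 * τ * Gamma (A + τ) * Gamma (A - τ) =
      Gamma (A + 1 + τ) * Gamma (A - τ) - Gamma (A + τ) * Gamma (A + 1 - τ) := by
  rw [show A + 1 + τ = A + τ + 1 by ring, show A + 1 - τ = A - τ + 1 by ring,
    Gamma_add_one _ h1, Gamma_add_one _ h2]
  ring

theorem ne_zero_of_re_pos {z : ℂ} (h : 0 < z.re) : z ≠ 0 := fun h0 => by simp [h0] at h

/-- The very-well-poised integral with one free parameter `u`. -/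
theorem verticalIntegral_vwp_one {A u : ℂ} {σ : ℝ} (hu : 0 < u.re) (hσ : u.re < σ)
    (hA : σ < A.re) :
    verticalIntegral σ (fun τ => 2 * τ * Gamma (A + τ) * Gamma (A - τ) *
      (Gamma (τ - u) / Gamma (1 + u + τ))) =
      Gamma (A - u) * Gamma (A + 1 / 2) / Gamma (1 / 2 + u) := by
  have n1 : Gamma (1 + 2 * u) ≠ 0 := Gamma_ne_zero_of_re_pos (by simp; linarith)
  have hfun : ∀ s : ℂ, ∀ x ∈ Ioo (0:ℝ) 1, (x : ℂ) ^ (s - u - 1) *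
      (1 - x : ℂ) ^ (1 + 2 * u - 1) = (x : ℂ) ^ s * ((x : ℂ) ^ (-u - 1) * (1 - x : ℂ) ^ (2 * u)) := by
    intro s x hx
    have : (x : ℂ) ≠ 0 := ofReal_ne_zero.2 (ne_of_gt hx.1)
    rw [show s - u - 1 = s + (-u - 1) by ring, cpow_add _ _ this, add_sub_cancel_left, mul_assoc]
  have hline : ∀ s : ℂ, s.re = σ → IntegrableOn (fun x : ℝ => (x : ℂ) ^ s *
      ((x : ℂ) ^ (-u - 1) * (1 - x : ℂ) ^ (2 * u))) (Ioo 0 1) ∧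
      ∫ x : ℝ in Ioo 0 1, (x : ℂ) ^ s * ((x : ℂ) ^ (-u - 1) * (1 - x : ℂ) ^ (2 * u)) =
        Gamma (s - u) * Gamma (1 + 2 * u) / Gamma (1 + u + s) := by
    intro s hs
    obtain ⟨h1, h2⟩ := setIntegral_Ioo_cpow_mul_one_sub_cpow (a := s - u) (b := 1 + 2 * u)
      (by simp; linarith) (by simp; linarith)
    refine ⟨h1.congr_fun (hfun s) measurableSet_Ioo, ?_⟩
    rw [← setIntegral_congr_fun measurableSet_Ioo (hfun s), h2]
    congr 2; ring
  have hi1 := verticalIntegrable_Gamma_add_mul_Gamma_sub (a := A + 1) (c := A) (σ := σ)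
    (by simp; linarith) (by simp; linarith)
  have hi2 := verticalIntegrable_Gamma_add_mul_Gamma_sub (a := A) (c := A + 1) (σ := σ)
    (by simp; linarith) (by simp; linarith)
  have hG : ∀ s : ℂ, s.re = σ → 2 * s * Gamma (A + s) * Gamma (A - s) =
      Gamma (A + 1 + s) * Gamma (A - s) - Gamma (A + s) * Gamma (A + 1 - s) := fun s hs =>
    two_mul_mul_Gamma_mul_Gamma (ne_zero_of_re_pos (by simp; linarith))
      (ne_zero_of_re_pos (by simp; linarith))
  have hint : VerticalIntegrable σ (fun s => 2 * s * Gamma (A + s) * Gamma (A - s)) :=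
    (hi1.sub hi2).congr (Filter.Eventually.of_forall fun y => (hG _ (by simp)).symm)
  have hker : ∀ x : ℝ, 0 < x →
      verticalIntegral σ (fun s => 2 * s * Gamma (A + s) * Gamma (A - s) * (x : ℂ) ^ s) =
        Gamma (2 * A + 1) * ((x : ℂ) ^ A * (1 - x) * (1 + x : ℂ) ^ (-(2 * A + 1))) := by
    intro x hx
    have h0 : (x : ℂ) ≠ 0 := ofReal_ne_zero.2 hx.ne'
    have hb : ∀ {f : ℂ → ℂ}, VerticalIntegrable σ f →
        VerticalIntegrable σ (fun s => f s * (x : ℂ) ^ s) := by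
      intro f hf
      have hc : Continuous fun y : ℝ => (x : ℂ) ^ (σ + y * I : ℂ) := by
        refine Continuous.const_cpow (by fun_prop) (Or.inl h0)
      refine Integrable.mul_of_top_left hf (memLp_top_of_bound hc.aestronglyMeasurable (x ^ σ)
        (Filter.Eventually.of_forall fun y => ?_))
      rw [norm_cpow_eq_rpow_re_of_pos hx]; simp
    rw [verticalIntegral_congr (g := fun s => Gamma (A + 1 + s) * Gamma (A - s) * (x : ℂ) ^ s -
      Gamma (A + s) * Gamma (A + 1 - s) * (x : ℂ) ^ s) (fun s hs => by rw [hG s hs, sub_mul]),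
      verticalIntegral_sub (hb hi1) (hb hi2),
      verticalIntegral_Gamma_mul_Gamma_mul_cpow (by simp; linarith) (by simp; linarith) hx,
      verticalIntegral_Gamma_mul_Gamma_mul_cpow (by simp; linarith) (by simp; linarith) hx,
      show A + 1 + A = 2 * A + 1 by ring, show A + (A + 1) = 2 * A + 1 by ring,
      cpow_add _ _ h0, cpow_one]
    ring
  have hdup : ∀ z : ℂ, Gamma (z + 1 / 2) * Gamma (1 + z) =
      Gamma (2 * z + 1) * (2 : ℂ) ^ (-(2 * z)) * (Real.sqrt Real.pi : ℂ) := by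
    intro z
    have := Complex.Gamma_mul_Gamma_add_half (z + 1 / 2)
    rw [show z + 1 / 2 + 1 / 2 = 1 + z by ring, show 2 * (z + 1 / 2) = 2 * z + 1 by ring,
      show 1 - (2 * z + 1) = -(2 * z) by ring] at this
    exact this
  calc _ = verticalIntegral σ (fun s => (Gamma (1 + 2 * u))⁻¹ *
        (2 * s * Gamma (A + s) * Gamma (A - s) * ∫ x : ℝ in Ioo 0 1,
          (x : ℂ) ^ s * ((x : ℂ) ^ (-u - 1) * (1 - x : ℂ) ^ (2 * u)))) := by
        refine verticalIntegral_congr fun s hs => ?_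
        rw [(hline s hs).2]; field_simp
    _ = (Gamma (1 + 2 * u))⁻¹ * ∫ x : ℝ in Ioo 0 1, Gamma (2 * A + 1) *
        ((x : ℂ) ^ (A - u - 1) * (1 - x : ℂ) ^ (2 * u + 1) * (1 + x : ℂ) ^ (-(2 * A + 1))) := by
        rw [verticalIntegral_const_mul, verticalIntegral_mul_setIntegral_cpow measurableSet_Ioo
          (fun x hx => hx.1) hint (hline σ (by simp)).1]
        congr 1
        refine setIntegral_congr_fun measurableSet_Ioo fun x hx => ?_
        have h0 : (x : ℂ) ≠ 0 := ofReal_ne_zero.2 hx.1.ne'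
        have h1 : (1 - x : ℂ) ≠ 0 := by
          rw [← ofReal_one, ← ofReal_sub]; exact ofReal_ne_zero.2 (sub_pos.2 hx.2).ne'
        rw [hker x hx.1, show A - u - 1 = A + (-u - 1) by ring, cpow_add _ _ h0,
          cpow_add _ _ h1, cpow_one]
        ring
    _ = _ := by
        rw [integral_const_mul, setIntegral_cpow_mul_one_sub_cpow_mul_one_add_cpow
          (by simp; linarith) (by simp; linarith)]
        have n2 : Gamma (1 / 2 + u) ≠ 0 := Gamma_ne_zero_of_re_pos (by simp; linarith)
        have n3 : Gamma (1 + A) ≠ 0 := Gamma_ne_zero_of_re_pos (by simp; linarith)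
        have n4 : (Real.sqrt Real.pi : ℂ) ≠ 0 :=
          ofReal_ne_zero.2 (Real.sqrt_pos.2 Real.pi_pos).ne'
        have hu' := hdup u
        have hA' := hdup A
        rw [show 2 * u - 2 * A = -(2 * A) - -(2 * u) by ring, cpow_sub _ _ two_ne_zero]
        have n5 : (2 : ℂ) ^ (-(2 * u)) ≠ 0 := by simp [cpow_eq_zero_iff]
        rw [add_comm (1 / 2) u] at n2 ⊢
        rw [add_comm 1 (2 * u)] at n1 ⊢
        generalize (1 / 2 : ℂ) = η at n2 hu' hA' ⊢
        field_simp
        refine mul_right_cancel₀ n4 ?_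
        linear_combination Gamma (A - u) * Gamma (A + η) * Gamma (1 + A) * hu' -
          Gamma (1 + u) * Gamma (A - u) * Gamma (u + η) * hA'

/-- The very-well-poised integral with two free parameters. The quotient of Gamma functions of
`u`, `v` is expanded by Barnes' second lemma with third parameter `1 / 2`. -/
theorem verticalIntegral_vwp_two {A u v : ℂ} {σ : ℝ} (hu : 0 < u.re) (hv : 0 < v.re)
    (huσ : u.re < σ) (hvσ : v.re < σ) (hA : σ < A.re) :
    verticalIntegral σ (fun τ => 2 * τ * Gamma (A + τ) * Gamma (A - τ) *
      (Gamma (τ - u) * Gamma (τ - v) / (Gamma (1 + u + τ) * Gamma (1 + v + τ)))) =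
      Gamma (A - u) * Gamma (A - v) / Gamma (1 + u + v) := by
  obtain ⟨ρ, h1, h2⟩ := exists_between (show max u.re v.re < min σ (1 / 2 + u.re + v.re) from
    max_lt (lt_min huσ (by linarith)) (lt_min hvσ (by linarith)))
  obtain ⟨h2, h3⟩ := lt_min_iff.1 h2
  obtain ⟨h0, h1⟩ := max_lt_iff.1 h1
  have n1 : Gamma (1 / 2 + u) ≠ 0 := Gamma_ne_zero_of_re_pos (by simp; linarith)
  have n2 : Gamma (1 / 2 + v) ≠ 0 := Gamma_ne_zero_of_re_pos (by simp; linarith)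
  have n3 : Gamma (1 + u + v) ≠ 0 := Gamma_ne_zero_of_re_pos (by simp; linarith)
  have n4 : Gamma (A + 1 / 2) ≠ 0 := Gamma_ne_zero_of_re_pos (by simp; linarith)
  set k : ℂ := (Gamma (1 / 2 + u) * Gamma (1 / 2 + v) * Gamma (1 + u + v))⁻¹ with hk
  have hII : ∀ τ : ℂ, τ.re = σ →
      Gamma (τ - u) * Gamma (τ - v) / (Gamma (1 + u + τ) * Gamma (1 + v + τ)) = k *
      verticalIntegral ρ (fun w => Gamma (-u + w) * Gamma (-v + w) * Gamma (1 / 2 + w) *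
        Gamma (τ - w) * Gamma (1 / 2 + u + v - w) / Gamma (1 + τ + w)) := by
    intro τ hτ
    have n5 : Gamma (1 / 2 + τ) ≠ 0 := Gamma_ne_zero_of_re_pos (by simp; linarith)
    have := barnes_second (a := -u) (b := -v) (c := 1 / 2) (d := τ) (e := 1 / 2 + u + v) (σ := ρ)
      (by simp; linarith) (by simp; linarith) (by simp; linarith) (by simp; linarith)
      (by simp; linarith)
    rw [show -u + -v + 1 / 2 + τ + (1 / 2 + u + v) = 1 + τ by ring,
      show -u + -v + τ + (1 / 2 + u + v) = 1 / 2 + τ by ring,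
      show -u + 1 / 2 + τ + (1 / 2 + u + v) = 1 + v + τ by ring,
      show -v + 1 / 2 + τ + (1 / 2 + u + v) = 1 + u + τ by ring,
      show 1 / 2 + (1 / 2 + u + v) = 1 + u + v by ring,
      show -u + (1 / 2 + u + v) = 1 / 2 + v by ring,
      show -v + (1 / 2 + u + v) = 1 / 2 + u by ring,
      show -u + τ = τ - u by ring, show -v + τ = τ - v by ring] at this
    rw [this, hk]
    generalize (1 / 2 : ℂ) = η at n1 n2 n5 ⊢
    field_simp
  have hw : ∀ w : ℂ, w.re = ρ → verticalIntegral σ (fun τ => 2 * τ * Gamma (A + τ) * Gamma (A - τ) *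
      (Gamma (-u + w) * Gamma (-v + w) * Gamma (1 / 2 + w) *
        Gamma (τ - w) * Gamma (1 / 2 + u + v - w) / Gamma (1 + τ + w))) =
      Gamma (A + 1 / 2) *
        (Gamma (-u + w) * Gamma (-v + w) * Gamma (1 / 2 + u + v - w) * Gamma (A - w)) := by
    intro w hw
    have n5 : Gamma (1 / 2 + w) ≠ 0 := Gamma_ne_zero_of_re_pos (by simp; linarith)
    rw [show (fun τ => 2 * τ * Gamma (A + τ) * Gamma (A - τ) *
      (Gamma (-u + w) * Gamma (-v + w) * Gamma (1 / 2 + w) *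
        Gamma (τ - w) * Gamma (1 / 2 + u + v - w) / Gamma (1 + τ + w))) = fun τ =>
      (Gamma (-u + w) * Gamma (-v + w) * Gamma (1 / 2 + w) * Gamma (1 / 2 + u + v - w)) *
        (2 * τ * Gamma (A + τ) * Gamma (A - τ) * (Gamma (τ - w) / Gamma (1 + w + τ))) by
        ext τ; rw [show 1 + τ + w = 1 + w + τ by ring]; ring,
      verticalIntegral_const_mul, verticalIntegral_vwp_one (by linarith) (by linarith) hA]
    generalize (1 / 2 : ℂ) = η at n5 ⊢
    field_simp
  calc _ = verticalIntegral σ (fun τ => k * verticalIntegral ρ (fun w =>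
        2 * τ * Gamma (A + τ) * Gamma (A - τ) *
        (Gamma (-u + w) * Gamma (-v + w) * Gamma (1 / 2 + w) *
          Gamma (τ - w) * Gamma (1 / 2 + u + v - w) / Gamma (1 + τ + w)))) := by
        refine verticalIntegral_congr fun τ hτ => ?_
        rw [verticalIntegral_const_mul, hII τ hτ]; ring
    _ = k * verticalIntegral ρ (fun w => Gamma (A + 1 / 2) *
        (Gamma (-u + w) * Gamma (-v + w) * Gamma (1 / 2 + u + v - w) * Gamma (A - w))) := by
        rw [verticalIntegral_const_mul, verticalIntegral_swap]
        · rw [verticalIntegral_congr hw]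
        · refine ExpBounded.integrable_prod (.mul
            (.mul (.mul
              (expBounded_linear (a := 2 * σ) (b := 2 * I) (l := fun p => p.1) (by fun_prop)
                fun p => by ring)
              (expBounded_Gamma (a := A + σ) (l := fun p => p.1) ?_ (by fun_prop)
                fun p => by ring))
              (expBounded_Gamma (a := A - σ) (l := fun p => -p.1) ?_ (by fun_prop)
                fun p => by push_cast; ring))
            (.div (.mul (.mul (.mul (.mul
              (expBounded_Gamma (a := -u + ρ) (l := fun p => p.2) ?_ (by fun_prop)
                fun p => by ring)
              (expBounded_Gamma (a := -v + ρ) (l := fun p => p.2) ?_ (by fun_prop)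
                fun p => by ring))
              (expBounded_Gamma (a := 1 / 2 + ρ) (l := fun p => p.2) ?_ (by fun_prop)
                fun p => by ring))
              (expBounded_Gamma (a := σ - ρ) (l := fun p => p.1 - p.2) ?_ (by fun_prop)
                fun p => by push_cast; ring))
              (expBounded_Gamma (a := 1 / 2 + u + v - ρ) (l := fun p => -p.2) ?_ (by fun_prop)
                fun p => by push_cast; ring))
              (expBounded_inv_Gamma (a := 1 + σ + ρ) (l := fun p => p.1 + p.2) (by fun_prop)
                fun p => by push_cast; ring))) (δ := 1 / 2) (D := 0) (by norm_num) ?_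
          case refine_8 =>
            intro p
            simp only [abs_neg]
            -- `Γ(τ - w) / Γ(1 + τ + w)` grows at most at rate `π` in `w`.
            have e1 : |p.1 + p.2| ≤ |p.1 - p.2| + 2 * |p.2| := by
              calc |p.1 + p.2| = |(p.1 - p.2) + 2 * p.2| := by ring_nf
                _ ≤ _ := (abs_add_le _ _).trans (by rw [abs_mul, abs_two])
            linarith [abs_nonneg p.1, abs_nonneg p.2, abs_add_le p.1 p.2]
          all_goals simp
          all_goals linarith
    _ = _ := by
        rw [verticalIntegral_const_mul, barnes_first (by simp; linarith)
          (by simp; linarith) (by simp; linarith) (by simp; linarith),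
          show -u + -v + (1 / 2 + u + v) + A = A + 1 / 2 by ring,
          show -u + (1 / 2 + u + v) = 1 / 2 + v by ring,
          show -v + (1 / 2 + u + v) = 1 / 2 + u by ring,
          show -u + A = A - u by ring, show -v + A = A - v by ring, hk]
        generalize (1 / 2 : ℂ) = η at n1 n2 n4 ⊢
        field_simp

/-- The very-well-poised integral with three free parameters: the integral analogue of the
very-well-poised `₅F₄` sum. -/
theorem verticalIntegral_vwp_three {A B u v : ℂ} {σ : ℝ} (hu : 0 < u.re) (hv : 0 < v.re)
    (huσ : u.re < σ) (hvσ : v.re < σ) (hA : σ < A.re) (hB : σ < B.re) :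
    verticalIntegral σ (fun τ => 2 * τ * (Gamma (A + τ) * Gamma (A - τ) * Gamma (B + τ) *
      Gamma (B - τ)) *
      (Gamma (τ - u) * Gamma (τ - v) / (Gamma (1 + u + τ) * Gamma (1 + v + τ)))) =
      Gamma (A + B) * (Gamma (A - u) * Gamma (A - v) * Gamma (B - u) * Gamma (B - v)) /
        (Gamma (1 + u + v) * Gamma (A + B - u - v)) := by
  obtain ⟨ρ, h1, h2⟩ := exists_between (lt_min hA hB)
  obtain ⟨h2, h3⟩ := lt_min_iff.1 h2
  have n1 : Gamma (A + B) ≠ 0 := Gamma_ne_zero_of_re_pos (by simp; linarith)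
  have hI : ∀ τ : ℂ, τ.re = σ → Gamma (A + τ) * Gamma (A - τ) * Gamma (B + τ) * Gamma (B - τ) =
      Gamma (A + B) * verticalIntegral ρ (fun w => Gamma (τ + w) * Gamma (-τ + w) *
        Gamma (A - w) * Gamma (B - w)) := by
    intro τ hτ
    rw [barnes_first (by simp; linarith) (by simp; linarith) (by simp; linarith)
      (by simp; linarith), show τ + -τ + A + B = A + B by ring, add_comm τ, add_comm τ,
      neg_add_eq_sub, neg_add_eq_sub]
    field_simp
  have hw : ∀ w : ℂ, w.re = ρ → verticalIntegral σ (fun τ => 2 * τ * (Gamma (τ + w) *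
      Gamma (-τ + w) * Gamma (A - w) * Gamma (B - w)) *
      (Gamma (τ - u) * Gamma (τ - v) / (Gamma (1 + u + τ) * Gamma (1 + v + τ)))) =
      (Gamma (1 + u + v))⁻¹ *
        (Gamma (-u + w) * Gamma (-v + w) * Gamma (A - w) * Gamma (B - w)) := by
    intro w hw
    rw [show (fun τ => 2 * τ * (Gamma (τ + w) *
      Gamma (-τ + w) * Gamma (A - w) * Gamma (B - w)) *
      (Gamma (τ - u) * Gamma (τ - v) / (Gamma (1 + u + τ) * Gamma (1 + v + τ)))) = fun τ =>
      (Gamma (A - w) * Gamma (B - w)) * (2 * τ * Gamma (w + τ) * Gamma (w - τ) *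
      (Gamma (τ - u) * Gamma (τ - v) / (Gamma (1 + u + τ) * Gamma (1 + v + τ)))) by
        ext τ; rw [add_comm w, neg_add_eq_sub]; ring,
      verticalIntegral_const_mul, verticalIntegral_vwp_two hu hv huσ hvσ (by linarith),
      neg_add_eq_sub, neg_add_eq_sub]
    ring
  calc _ = verticalIntegral σ (fun τ => Gamma (A + B) * verticalIntegral ρ (fun w =>
        2 * τ * (Gamma (τ + w) * Gamma (-τ + w) * Gamma (A - w) * Gamma (B - w)) *
      (Gamma (τ - u) * Gamma (τ - v) / (Gamma (1 + u + τ) * Gamma (1 + v + τ))))) := by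
        refine verticalIntegral_congr fun τ hτ => ?_
        rw [hI τ hτ, show (fun w => 2 * τ * (Gamma (τ + w) * Gamma (-τ + w) * Gamma (A - w) *
          Gamma (B - w)) *
          (Gamma (τ - u) * Gamma (τ - v) / (Gamma (1 + u + τ) * Gamma (1 + v + τ)))) = fun w =>
          (2 * τ *
          (Gamma (τ - u) * Gamma (τ - v) / (Gamma (1 + u + τ) * Gamma (1 + v + τ)))) *
          (Gamma (τ + w) * Gamma (-τ + w) * Gamma (A - w) * Gamma (B - w)) by ext w; ring,
          verticalIntegral_const_mul]
        ring
    _ = Gamma (A + B) * verticalIntegral ρ (fun w => (Gamma (1 + u + v))⁻¹ *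
        (Gamma (-u + w) * Gamma (-v + w) * Gamma (A - w) * Gamma (B - w))) := by
        rw [verticalIntegral_const_mul, verticalIntegral_swap]
        · rw [verticalIntegral_congr hw]
        · refine ExpBounded.integrable_prod (.mul
            (.mul
              (expBounded_linear (a := 2 * σ) (b := 2 * I) (l := fun p => p.1) (by fun_prop)
                fun p => by ring)
            (.mul (.mul (.mul
              (expBounded_Gamma (a := σ + ρ) (l := fun p => p.1 + p.2) ?_ (by fun_prop)
                fun p => by push_cast; ring)
              (expBounded_Gamma (a := -σ + ρ) (l := fun p => -p.1 + p.2) ?_ (by fun_prop)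
                fun p => by push_cast; ring))
              (expBounded_Gamma (a := A - ρ) (l := fun p => -p.2) ?_ (by fun_prop)
                fun p => by push_cast; ring))
              (expBounded_Gamma (a := B - ρ) (l := fun p => -p.2) ?_ (by fun_prop)
                fun p => by push_cast; ring)))
            (.div (.mul
              (expBounded_Gamma (a := σ - u) (l := fun p => p.1) ?_ (by fun_prop)
                fun p => by ring)
              (expBounded_Gamma (a := σ - v) (l := fun p => p.1) ?_ (by fun_prop)
                fun p => by ring))
              (.inv_mul
              (expBounded_inv_Gamma (a := 1 + u + σ) (l := fun p => p.1) (by fun_prop)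
                fun p => by ring)
              (expBounded_inv_Gamma (a := 1 + v + σ) (l := fun p => p.1) (by fun_prop)
                fun p => by ring)))) (δ := 1 / 2) (D := 0) (by norm_num) ?_
          case refine_7 =>
            intro p
            simp only [abs_neg]
            have e1 : 2 * |p.1| ≤ |p.1 + p.2| + |-p.1 + p.2| := by
              calc 2 * |p.1| = |(p.1 + p.2) - (-p.1 + p.2)| := by
                    rw [← abs_two, ← abs_mul]; ring_nf
                _ ≤ _ := abs_sub _ _
            linarith [abs_nonneg p.1, abs_nonneg p.2]
          all_goals simp
          all_goals linarith
    _ = _ := by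
        rw [verticalIntegral_const_mul, barnes_first (by simp; linarith)
          (by simp; linarith) (by simp; linarith) (by simp; linarith),
          show -u + -v + A + B = A + B - u - v by ring, neg_add_eq_sub, neg_add_eq_sub,
          neg_add_eq_sub, neg_add_eq_sub]
        have n2 : Gamma (A + B - u - v) ≠ 0 := Gamma_ne_zero_of_re_pos (by simp; linarith)
        have n3 : Gamma (1 + u + v) ≠ 0 := Gamma_ne_zero_of_re_pos (by simp; linarith)
        field_simp

/-! ### Moving the line of integration -/

theorem verticalIntegrable_of_norm_le {f : ℂ → ℂ} {c C : ℝ}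
    (hd : ContinuousOn f {z | z.re = c})
    (hb : ∀ z : ℂ, z.re = c → ‖f z‖ ≤ C * Real.exp (-|z.im|)) : VerticalIntegrable c f := by
  have hc : Continuous fun y : ℝ => f (c + y * I) :=
    hd.comp_continuous (by fun_prop) (fun y => by simp)
  refine ((integrable_exp_neg_mul_abs one_pos).const_mul C).mono' hc.aestronglyMeasurable
    (Eventually.of_forall fun y => ?_)
  simpa using hb (c + y * I) (by simp)

/-- Cauchy's theorem on a vertical strip: the vertical integral of an exponentially decaying
holomorphic function does not depend on the line. -/
theorem verticalIntegral_eq_of_strip {f : ℂ → ℂ} {c d C : ℝ} (hcd : c ≤ d)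
    (hd : DifferentiableOn ℂ f {z | c ≤ z.re ∧ z.re ≤ d})
    (hb : ∀ z : ℂ, c ≤ z.re → z.re ≤ d → ‖f z‖ ≤ C * Real.exp (-|z.im|)) :
    verticalIntegral c f = verticalIntegral d f := by
  have hic : VerticalIntegrable c f := verticalIntegrable_of_norm_le
    (hd.continuousOn.mono fun z hz => ⟨hz.ge, hz.le.trans hcd⟩)
    fun z hz => hb z hz.ge (hz.le.trans hcd)
  have hid : VerticalIntegrable d f := verticalIntegrable_of_norm_le
    (hd.continuousOn.mono fun z hz => ⟨hcd.trans hz.ge, hz.le⟩)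
    fun z hz => hb z (hcd.trans hz.ge) hz.le
  have hrect : ∀ T : ℝ, (∫ x : ℝ in c..d, f (x + (-T : ℝ) * I)) - (∫ x : ℝ in c..d, f (x + T * I)) +
      I • (∫ y : ℝ in (-T)..T, f (d + y * I)) - I • (∫ y : ℝ in (-T)..T, f (c + y * I)) = 0 := by
    intro T
    have := integral_boundary_rect_eq_zero_of_differentiableOn f ⟨c, -T⟩ ⟨d, T⟩
      (hd.mono fun z hz => by
        have := (mem_reProdIm.1 hz).1
        rwa [uIcc_of_le hcd] at this)
    simpa using this
  have hlim : ∀ s : ℝ, |s| = 1 → Tendsto (fun T : ℝ => ∫ x : ℝ in c..d, f (x + (s * T : ℝ) * I))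
      atTop (𝓝 0) := by
    intro s hs
    have h0 : Tendsto (fun T : ℝ => C * Real.exp (-T) * |d - c|) atTop (𝓝 0) := by
      simpa using (Real.tendsto_exp_neg_atTop_nhds_zero.const_mul C).mul_const |d - c|
    refine squeeze_zero_norm' ?_ h0
    filter_upwards [eventually_ge_atTop 0] with T hT
    refine intervalIntegral.norm_integral_le_of_norm_le_const fun x hx => ?_
    rw [uIoc_of_le hcd] at hx
    have := hb (x + (s * T : ℝ) * I) (by simpa using hx.1.le) (by simpa using hx.2)
    simpa [abs_mul, hs, abs_of_nonneg hT] using this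
  have h1 := hlim (-1) (by simp)
  have h2 := hlim 1 (by simp)
  simp only [neg_mul, one_mul] at h1 h2
  have h3 := intervalIntegral_tendsto_integral hic tendsto_neg_atTop_atBot tendsto_id
  have h4 := intervalIntegral_tendsto_integral hid tendsto_neg_atTop_atBot tendsto_id
  have h5 := ((h1.sub h2).add (h4.const_smul I)).sub (h3.const_smul I)
  have h6 := tendsto_nhds_unique (h5.congr fun T => hrect T) tendsto_const_nhds
  rw [verticalIntegral_eq, verticalIntegral_eq]
  have h7 : I • ((∫ y : ℝ, f (d + y * I)) - ∫ y : ℝ, f (c + y * I)) = 0 := by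
    rw [smul_sub]; simpa using h6
  rw [smul_eq_mul, mul_eq_zero, or_iff_right I_ne_zero, sub_eq_zero] at h7
  rw [h7]

/-- The outer one of three vertical integrals moved innermost. -/
theorem verticalIntegral_swap_swap {c d e : ℝ} {f : ℂ → ℂ → ℂ → ℂ}
    (h : Integrable (fun p : ℝ × ℝ × ℝ => f (c + p.1 * I) (d + p.2.1 * I) (e + p.2.2 * I))
      (volume.prod (volume.prod volume))) :
    verticalIntegral c (fun t => verticalIntegral d (fun w => verticalIntegral e (fun s => f t w s)))
      = verticalIntegral d (fun w => verticalIntegral e (fun s =>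
        verticalIntegral c (fun t => f t w s))) := by
  simp only [verticalIntegral_eq, integral_const_mul]
  have h1 : ∫ x : ℝ, ∫ y : ℝ, ∫ z : ℝ, f (c + x * I) (d + y * I) (e + z * I) =
      ∫ x : ℝ, ∫ p : ℝ × ℝ, f (c + x * I) (d + p.1 * I) (e + p.2 * I)
        ∂(volume.prod volume) := by
    refine integral_congr_ae ?_
    filter_upwards [h.prod_right_ae] with x hx
    rw [integral_prod _ hx]
  have h2 : ∫ p : ℝ × ℝ, (∫ x : ℝ, f (c + x * I) (d + p.1 * I) (e + p.2 * I))
        ∂(volume.prod volume) =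
      ∫ y : ℝ, ∫ z : ℝ, ∫ x : ℝ, f (c + x * I) (d + y * I) (e + z * I) :=
    integral_prod _ h.integral_prod_right
  rw [h1, integral_integral_swap (f := fun (x : ℝ) (p : ℝ × ℝ) =>
    f (c + x * I) (d + p.1 * I) (e + p.2 * I)) h, h2]

/-! ### The double integral for general parameters -/

/-- A well-poised quotient of three pairs of Gamma functions as a Barnes integral. -/
theorem Gamma_triple_quotient_eq {h₀ a b c t : ℂ} {σ : ℝ} (ha : -a.re < σ) (hb : -b.re < σ)
    (hc : -c.re < σ) (ht : σ < t.re) (he : σ < (1 + h₀ - a - b - c).re) :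
    Gamma (a + t) * Gamma (b + t) * Gamma (c + t) /
      (Gamma (1 + h₀ - a + t) * Gamma (1 + h₀ - b + t) * Gamma (1 + h₀ - c + t)) =
    (Gamma (1 + h₀ - a - b) * Gamma (1 + h₀ - a - c) * Gamma (1 + h₀ - b - c))⁻¹ *
      verticalIntegral σ (fun s => Gamma (a + s) * Gamma (b + s) * Gamma (c + s) *
        Gamma (t - s) * Gamma (1 + h₀ - a - b - c - s) / Gamma (1 + h₀ + t + s)) := by
  simp only [add_re, sub_re, one_re] at he
  have := barnes_second (a := a) (b := b) (c := c) (d := t) (e := 1 + h₀ - a - b - c) (σ := σ)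
    (by simp; linarith) (by simp; linarith) (by simp; linarith) (by simp; linarith)
    (by simp; linarith)
  rw [show a + b + c + t + (1 + h₀ - a - b - c) = 1 + h₀ + t by ring,
    show a + b + t + (1 + h₀ - a - b - c) = 1 + h₀ - c + t by ring,
    show a + c + t + (1 + h₀ - a - b - c) = 1 + h₀ - b + t by ring,
    show b + c + t + (1 + h₀ - a - b - c) = 1 + h₀ - a + t by ring,
    show a + (1 + h₀ - a - b - c) = 1 + h₀ - b - c by ring,
    show b + (1 + h₀ - a - b - c) = 1 + h₀ - a - c by ring,
    show c + (1 + h₀ - a - b - c) = 1 + h₀ - a - b by ring] at this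
  have n1 : Gamma (1 + h₀ - b - c) ≠ 0 := Gamma_ne_zero_of_re_pos (by simp; linarith)
  have n2 : Gamma (1 + h₀ - a - c) ≠ 0 := Gamma_ne_zero_of_re_pos (by simp; linarith)
  have n3 : Gamma (1 + h₀ - a - b) ≠ 0 := Gamma_ne_zero_of_re_pos (by simp; linarith)
  rw [this]
  field_simp

/-- The numerator `Γ(h_i+z)Γ(h_j+z)Γ(h_l+z)Γ(1+h₀-h_i-h_j-h_l-z)Γ(h₋₁-h₀-z)Γ(-z)`, with
`a b c` for `h_i h_j h_l` and `k` for `h₋₁`. -/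
noncomputable def tripleKernel (h₀ k a b c z : ℂ) : ℂ :=
  Gamma (a + z) * Gamma (b + z) * Gamma (c + z) * Gamma (1 + h₀ - a - b - c - z) *
    (Gamma (-z) * Gamma (k - h₀ - z))

/-- The coupling `1 / (Γ(1+h₀+x)Γ(h₋₁-h₀-x))`, with `k` for `h₋₁`. -/
noncomputable def inverseBetaKernel (h₀ k x : ℂ) : ℂ := 1 / (Gamma (1 + h₀ + x) * Gamma (k - h₀ - x))

theorem expBounded_tripleKernel {h₀ k a b c : ℂ} {σ : ℝ} (ha : -a.re < σ) (hb : -b.re < σ)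
    (hc : -c.re < σ) (h0 : σ < 0) (hk : σ < (k - h₀).re) (he : σ < (1 + h₀ - a - b - c).re) :
    ExpBounded (fun y : ℝ => tripleKernel h₀ k a b c (σ + y * I)) (fun y => -9 * |y|) := by
  simp only [add_re, sub_re, one_re] at he hk
  refine ExpBounded.mono (.mul (.mul (.mul (.mul
    (expBounded_Gamma (a := a + σ) (l := fun y => y) ?_ (by fun_prop) fun y => by ring)
    (expBounded_Gamma (a := b + σ) (l := fun y => y) ?_ (by fun_prop) fun y => by ring))
    (expBounded_Gamma (a := c + σ) (l := fun y => y) ?_ (by fun_prop) fun y => by ring))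
    (expBounded_Gamma (a := 1 + h₀ - a - b - c - σ) (l := fun y => -y) ?_ (by fun_prop)
      fun y => by push_cast; ring))
    (.mul
    (expBounded_Gamma (a := -σ) (l := fun y => -y) ?_ (by fun_prop) fun y => by push_cast; ring)
    (expBounded_Gamma (a := k - h₀ - σ) (l := fun y => -y) ?_ (by fun_prop)
      fun y => by push_cast; ring))) (D := 0) ?_
  case refine_7 =>
    intro y
    simp only [abs_neg]
    linarith
  all_goals simp
  all_goals linarith

theorem expBounded_inverseBetaKernel {X : Type*} [TopologicalSpace X] (h₀ k a : ℂ) {l : X → ℝ}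
    (hl : Continuous l) {z : X → ℂ} (hz : ∀ x, z x = a + l x * I) :
    ExpBounded (fun x => inverseBetaKernel h₀ k (z x)) (fun x => 16 / 5 * |l x|) := by
  refine ExpBounded.mono (.div (expBounded_const 1) (.inv_mul
    (expBounded_inv_Gamma (a := 1 + h₀ + a) hl fun x => by rw [hz]; ring)
    (expBounded_inv_Gamma (a := k - h₀ - a) hl.neg fun x => by rw [hz, Pi.neg_apply]; push_cast; ring)))
    (D := 0) fun x => ?_
  simp only [Pi.neg_apply, abs_neg]
  linarith

/-- The very-well-poised integral over `t` left over after both triples of Gamma functions have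
been expanded; it is `verticalIntegral_vwp_three` translated by `h₀ / 2`. -/
theorem verticalIntegral_vwp_inner {h₀ k s w : ℂ} {c : ℝ} (hs : -h₀.re < 2 * s.re)
    (hw : -h₀.re < 2 * w.re) (hsc : s.re < c) (hwc : w.re < c) (hc : c < 0)
    (hk : c < (k - h₀).re) :
    verticalIntegral c (fun t => (h₀ + 2 * t) *
      (Gamma (h₀ + t) * Gamma (-t) * Gamma (k + t) * Gamma (k - h₀ - t)) *
      (Gamma (t - s) * Gamma (t - w) / (Gamma (1 + h₀ + t + s) * Gamma (1 + h₀ + t + w)))) =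
      Gamma k * (Gamma (-s) * Gamma (-w) * Gamma (k - h₀ - s) * Gamma (k - h₀ - w)) *
        inverseBetaKernel h₀ k (s + w) := by
  simp only [sub_re] at hk
  have e := verticalIntegral_vwp_three (A := h₀ / 2) (B := k - h₀ / 2) (u := s + h₀ / 2)
    (v := w + h₀ / 2) (σ := c + (h₀ / 2).re) (by simp; linarith) (by simp; linarith)
    (by simp; linarith) (by simp; linarith) (by simp; linarith) (by simp; linarith)
  rw [← verticalIntegral_comp_add] at e
  rw [inverseBetaKernel, mul_one_div]
  convert! e using 1
  · refine verticalIntegral_congr fun t _ => ?_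
    rw [show 2 * (t + h₀ / 2) = h₀ + 2 * t by ring, show h₀ / 2 + (t + h₀ / 2) = h₀ + t by ring,
      show h₀ / 2 - (t + h₀ / 2) = -t by ring, show k - h₀ / 2 + (t + h₀ / 2) = k + t by ring,
      show k - h₀ / 2 - (t + h₀ / 2) = k - h₀ - t by ring,
      show t + h₀ / 2 - (s + h₀ / 2) = t - s by ring,
      show t + h₀ / 2 - (w + h₀ / 2) = t - w by ring,
      show 1 + (s + h₀ / 2) + (t + h₀ / 2) = 1 + h₀ + t + s by ring,
      show 1 + (w + h₀ / 2) + (t + h₀ / 2) = 1 + h₀ + t + w by ring]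
  · rw [show h₀ / 2 + (k - h₀ / 2) = k by ring, show h₀ / 2 - (s + h₀ / 2) = -s by ring,
      show h₀ / 2 - (w + h₀ / 2) = -w by ring, show k - h₀ / 2 - (s + h₀ / 2) = k - h₀ - s by ring,
      show k - h₀ / 2 - (w + h₀ / 2) = k - h₀ - w by ring,
      show 1 + (s + h₀ / 2) + (w + h₀ / 2) = 1 + h₀ + (s + w) by ring,
      show k - (s + h₀ / 2) - (w + h₀ / 2) = k - h₀ - (s + w) by ring]

/-- The double integral obtained by expanding two triples of Gamma functions, on a line `Re t = c`
to the right of both lines of integration of the expansions. -/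
theorem verticalIntegral_vwp_six {h₀ k a₁ a₂ a₃ b₁ b₂ b₃ : ℂ} {c d e : ℝ}
    (ha₁ : -a₁.re < d) (ha₂ : -a₂.re < d) (ha₃ : -a₃.re < d)
    (hb₁ : -b₁.re < e) (hb₂ : -b₂.re < e) (hb₃ : -b₃.re < e)
    (hd : d < (1 + h₀ - a₁ - a₂ - a₃).re) (he : e < (1 + h₀ - b₁ - b₂ - b₃).re)
    (hd' : -h₀.re < 2 * d) (he' : -h₀.re < 2 * e) (hdc : d < c) (hec : e < c)
    (hc : c < 0) (hk : c < (k - h₀).re) :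
    verticalIntegral c (fun t => (h₀ + 2 * t) *
      (Gamma (h₀ + t) * Gamma (-t) * Gamma (k + t) * Gamma (k - h₀ - t)) *
      (Gamma (b₁ + t) * Gamma (b₂ + t) * Gamma (b₃ + t) /
        (Gamma (1 + h₀ - b₁ + t) * Gamma (1 + h₀ - b₂ + t) * Gamma (1 + h₀ - b₃ + t))) *
      (Gamma (a₁ + t) * Gamma (a₂ + t) * Gamma (a₃ + t) /
        (Gamma (1 + h₀ - a₁ + t) * Gamma (1 + h₀ - a₂ + t) * Gamma (1 + h₀ - a₃ + t)))) =
    Gamma k *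
      (Gamma (1 + h₀ - a₁ - a₂) * Gamma (1 + h₀ - a₁ - a₃) * Gamma (1 + h₀ - a₂ - a₃))⁻¹ *
      (Gamma (1 + h₀ - b₁ - b₂) * Gamma (1 + h₀ - b₁ - b₃) * Gamma (1 + h₀ - b₂ - b₃))⁻¹ *
      doubleIntegral e d (tripleKernel h₀ k b₁ b₂ b₃) (tripleKernel h₀ k a₁ a₂ a₃)
        (inverseBetaKernel h₀ k) := by
  set C₁ := (Gamma (1 + h₀ - a₁ - a₂) * Gamma (1 + h₀ - a₁ - a₃) * Gamma (1 + h₀ - a₂ - a₃))⁻¹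
  set C₂ := (Gamma (1 + h₀ - b₁ - b₂) * Gamma (1 + h₀ - b₁ - b₃) * Gamma (1 + h₀ - b₂ - b₃))⁻¹
  have hk' := hk
  have hd₁ := hd
  have he₁ := he
  simp only [add_re, sub_re, one_re] at hd₁ he₁ hk'
  set f : ℂ → ℂ → ℂ → ℂ := fun t w s => (h₀ + 2 * t) *
      (Gamma (h₀ + t) * Gamma (-t) * Gamma (k + t) * Gamma (k - h₀ - t)) *
      (Gamma (b₁ + w) * Gamma (b₂ + w) * Gamma (b₃ + w) *
        Gamma (t - w) * Gamma (1 + h₀ - b₁ - b₂ - b₃ - w) / Gamma (1 + h₀ + t + w)) *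
      (Gamma (a₁ + s) * Gamma (a₂ + s) * Gamma (a₃ + s) *
        Gamma (t - s) * Gamma (1 + h₀ - a₁ - a₂ - a₃ - s) / Gamma (1 + h₀ + t + s)) with hf
  calc _ = verticalIntegral c (fun t => C₁ * C₂ * verticalIntegral e (fun w =>
        verticalIntegral d (fun s => f t w s))) := by
        refine verticalIntegral_congr fun t ht => ?_
        rw [Gamma_triple_quotient_eq hb₁ hb₂ hb₃ (by linarith) he,
          Gamma_triple_quotient_eq ha₁ ha₂ ha₃ (by linarith) hd]
        simp only [hf, verticalIntegral_const_mul]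
        simp only [mul_comm _ (verticalIntegral d _), verticalIntegral_const_mul]
        ring
    _ = C₁ * C₂ * verticalIntegral e (fun w => verticalIntegral d (fun s =>
        verticalIntegral c (fun t => f t w s))) := by
        rw [verticalIntegral_const_mul, verticalIntegral_swap_swap]
        refine ExpBounded.integrable_prod_prod (.mul (.mul (.mul
            (expBounded_linear (a := h₀ + 2 * c) (b := 2 * I) (l := fun p => p.1) (by fun_prop)
                fun p => by ring)
            (.mul (.mul (.mul
              (expBounded_Gamma (a := h₀ + c) (l := fun p => p.1) ?_ (by fun_prop)
                fun p => by ring)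
              (expBounded_Gamma (a := -c) (l := fun p => -p.1) ?_ (by fun_prop)
                fun p => by push_cast; ring))
              (expBounded_Gamma (a := k + c) (l := fun p => p.1) ?_ (by fun_prop)
                fun p => by ring))
              (expBounded_Gamma (a := k - h₀ - c) (l := fun p => -p.1) ?_ (by fun_prop)
                fun p => by push_cast; ring)))
            (.div (.mul (.mul (.mul (.mul
              (expBounded_Gamma (a := b₁ + e) (l := fun p => p.2.1) ?_ (by fun_prop)
                fun p => by ring)
              (expBounded_Gamma (a := b₂ + e) (l := fun p => p.2.1) ?_ (by fun_prop)
                fun p => by ring))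
              (expBounded_Gamma (a := b₃ + e) (l := fun p => p.2.1) ?_ (by fun_prop)
                fun p => by ring))
              (expBounded_Gamma (a := c - e) (l := fun p => p.1 - p.2.1) ?_ (by fun_prop)
                fun p => by push_cast; ring))
              (expBounded_Gamma (a := 1 + h₀ - b₁ - b₂ - b₃ - e) (l := fun p => -p.2.1) ?_
                (by fun_prop) fun p => by push_cast; ring))
              (expBounded_inv_Gamma (a := 1 + h₀ + c + e) (l := fun p => p.1 + p.2.1)
                (by fun_prop) fun p => by push_cast; ring)))
            (.div (.mul (.mul (.mul (.mul
              (expBounded_Gamma (a := a₁ + d) (l := fun p => p.2.2) ?_ (by fun_prop)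
                fun p => by ring)
              (expBounded_Gamma (a := a₂ + d) (l := fun p => p.2.2) ?_ (by fun_prop)
                fun p => by ring))
              (expBounded_Gamma (a := a₃ + d) (l := fun p => p.2.2) ?_ (by fun_prop)
                fun p => by ring))
              (expBounded_Gamma (a := c - d) (l := fun p => p.1 - p.2.2) ?_ (by fun_prop)
                fun p => by push_cast; ring))
              (expBounded_Gamma (a := 1 + h₀ - a₁ - a₂ - a₃ - d) (l := fun p => -p.2.2) ?_
                (by fun_prop) fun p => by push_cast; ring))
              (expBounded_inv_Gamma (a := 1 + h₀ + c + d) (l := fun p => p.1 + p.2.2)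
                (by fun_prop) fun p => by push_cast; ring)))
            (δ := 1 / 2) (D := 0) (by norm_num) ?_
        case refine_15 =>
            intro p
            simp only [abs_neg]
            have e1 : ∀ x y : ℝ, |x + y| ≤ |x - y| + 2 * |y| := fun x y => by
              calc |x + y| = |(x - y) + 2 * y| := by ring_nf
                _ ≤ _ := (abs_add_le _ _).trans (by rw [abs_mul, abs_two])
            linarith [abs_nonneg p.1, abs_nonneg p.2.1, abs_nonneg p.2.2,
              abs_add_le p.1 p.2.1, abs_add_le p.1 p.2.2, e1 p.1 p.2.1, e1 p.1 p.2.2]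
        all_goals simp
        all_goals linarith
    _ = C₁ * C₂ * verticalIntegral e (fun w => Gamma k * (tripleKernel h₀ k b₁ b₂ b₃ w *
        verticalIntegral d (fun s =>
          tripleKernel h₀ k a₁ a₂ a₃ s * inverseBetaKernel h₀ k (s + w)))) := by
        congr 1
        refine verticalIntegral_congr fun w hw => ?_
        rw [← verticalIntegral_const_mul, ← verticalIntegral_const_mul]
        refine verticalIntegral_congr fun s hs => ?_
        calc _ = verticalIntegral c (fun t =>
            (Gamma (b₁ + w) * Gamma (b₂ + w) * Gamma (b₃ + w) *
              Gamma (1 + h₀ - b₁ - b₂ - b₃ - w) * (Gamma (a₁ + s) * Gamma (a₂ + s) *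
              Gamma (a₃ + s) * Gamma (1 + h₀ - a₁ - a₂ - a₃ - s))) * ((h₀ + 2 * t) *
            (Gamma (h₀ + t) * Gamma (-t) * Gamma (k + t) * Gamma (k - h₀ - t)) *
            (Gamma (t - s) * Gamma (t - w) /
              (Gamma (1 + h₀ + t + s) * Gamma (1 + h₀ + t + w))))) := by
              congr 1; ext t; simp only [hf]; ring
          _ = _ := by
              rw [verticalIntegral_const_mul, verticalIntegral_vwp_inner (by linarith)
                (by linarith) (by linarith) (by linarith) hc hk, tripleKernel, tripleKernel]
              ring
    _ = _ := by
        rw [verticalIntegral_const_mul, doubleIntegral]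
        ring

/-! ### Holomorphic functions of exponential growth on strips -/

/-- `f` is holomorphic on the strip `c ≤ Re z ≤ d` and bounded there by a multiple of
`exp (r |Im z|)`. -/
def StripBounded (c d : ℝ) (f : ℂ → ℂ) (r : ℝ) : Prop :=
  DifferentiableOn ℂ f {z | c ≤ z.re ∧ z.re ≤ d} ∧
    ∃ C : ℝ, 0 ≤ C ∧ ∀ z : ℂ, c ≤ z.re → z.re ≤ d → ‖f z‖ ≤ C * Real.exp (r * |z.im|)

theorem StripBounded.mul {c d r s : ℝ} {f g : ℂ → ℂ} (hf : StripBounded c d f r)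
    (hg : StripBounded c d g s) : StripBounded c d (fun z => f z * g z) (r + s) := by
  obtain ⟨hf, C, hC, h⟩ := hf
  obtain ⟨hg, D, hD, h'⟩ := hg
  refine ⟨hf.mul hg, C * D, by positivity, fun z h1 h2 => ?_⟩
  rw [norm_mul, add_mul, Real.exp_add]
  calc _ ≤ (C * Real.exp (r * |z.im|)) * (D * Real.exp (s * |z.im|)) := by
        gcongr
        exacts [h z h1 h2, h' z h1 h2]
    _ = _ := by ring

theorem StripBounded.comp_neg {c d r : ℝ} {f : ℂ → ℂ} (hf : StripBounded (-d) (-c) f r) :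
    StripBounded c d (fun z => f (-z)) r := by
  obtain ⟨hf, C, hC, h⟩ := hf
  refine ⟨hf.comp differentiable_neg.differentiableOn fun z hz => ?_, C, hC, fun z h1 h2 => ?_⟩
  · exact ⟨by simpa using hz.2, by simpa using hz.1⟩
  · simpa using h (-z) (by simpa using h2) (by simpa using h1)

theorem stripBounded_linear (a b : ℂ) (c d : ℝ) : StripBounded c d (fun z => a + b * z) 1 := by
  obtain ⟨C, hC, h⟩ := exists_norm_le_exp (max |c| |d|) one_pos
  refine ⟨by fun_prop, ‖a‖ + ‖b‖ * C, by positivity, fun z h1 h2 => ?_⟩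
  have h3 := h z (abs_le_max_abs_abs h1 h2)
  have h4 : 1 ≤ Real.exp (1 * |z.im|) := Real.one_le_exp (by positivity)
  calc _ ≤ ‖a‖ * 1 + ‖b‖ * ‖z‖ := by
        refine (norm_add_le _ _).trans (le_of_eq ?_)
        rw [norm_mul, mul_one]
    _ ≤ ‖a‖ * Real.exp (1 * |z.im|) + ‖b‖ * (C * Real.exp (1 * |z.im|)) := by gcongr
    _ = _ := by ring

theorem stripBounded_Gamma_add {a : ℂ} {c : ℝ} (d : ℝ) (ha : 0 < a.re + c) :
    StripBounded c d (fun z => Gamma (a + z)) (-(3 / 2)) := by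
  obtain ⟨C, hC, h⟩ := exists_norm_Gamma_le ha (a.re + d) (a := 3 / 2)
    (by linarith [Real.pi_gt_d2])
  refine ⟨fun z hz => ?_, C * Real.exp (3 / 2 * |a.im|), by positivity, fun z h1 h2 => ?_⟩
  · refine (DifferentiableAt.comp z (differentiableAt_Gamma _ fun m hm => ?_)
      (by fun_prop)).differentiableWithinAt
    have h3 := congrArg re hm
    have h4 := hz.1
    simp at h3
    have : (0:ℝ) ≤ m := m.cast_nonneg
    linarith
  · refine (h (a + z) (by simpa using h1) (by simpa using h2)).trans ?_
    rw [mul_assoc, ← Real.exp_add]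
    have := abs_sub (a.im + z.im) a.im
    simp only [add_sub_cancel_left] at this
    gcongr
    simp only [add_im]
    linarith

theorem stripBounded_Gamma_sub {a : ℂ} (c : ℝ) {d : ℝ} (ha : 0 < a.re - d) :
    StripBounded c d (fun z => Gamma (a - z)) (-(3 / 2)) := by
  simpa only [sub_eq_add_neg] using
    (stripBounded_Gamma_add (a := a) (c := -d) (-c) (by linarith)).comp_neg

theorem stripBounded_inv_Gamma_add (a : ℂ) (c d : ℝ) :
    StripBounded c d (fun z => (Gamma (a + z))⁻¹) (8 / 5) := by
  obtain ⟨C, hC, h⟩ := exists_norm_inv_Gamma_le (a.re + c) (a.re + d) (b := 8 / 5)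
    (by linarith [Real.pi_lt_d2])
  refine ⟨?_, C * Real.exp (8 / 5 * |a.im|), by positivity, fun z h1 h2 => ?_⟩
  · exact (differentiable_one_div_Gamma.comp
      (by fun_prop : Differentiable ℂ fun z => a + z)).differentiableOn
  · refine (h (a + z) (by simpa using h1) (by simpa using h2)).trans ?_
    rw [mul_assoc, ← Real.exp_add]
    have := abs_add_le a.im z.im
    gcongr
    simp only [add_im]
    linarith

/-! ### Expanding the very-well-poised integral -/

/-- The very-well-poised integrand with its Gamma functions grouped into the two triples. -/
theorem vwpIntegrand_six (h : ℤ → ℂ) : vwpIntegrand 6 h = fun t => (h 0 + 2 * t) *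
      (Gamma (h 0 + t) * Gamma (-t) * Gamma (h (-1) + t) * Gamma (h (-1) - h 0 - t)) *
      (Gamma (h 4 + t) * Gamma (h 5 + t) * Gamma (h 6 + t) /
        (Gamma (1 + h 0 - h 4 + t) * Gamma (1 + h 0 - h 5 + t) * Gamma (1 + h 0 - h 6 + t))) *
      (Gamma (h 1 + t) * Gamma (h 2 + t) * Gamma (h 3 + t) /
        (Gamma (1 + h 0 - h 1 + t) * Gamma (1 + h 0 - h 2 + t) * Gamma (1 + h 0 - h 3 + t))) := by
  ext t
  have e1 : Finset.Icc (-1 : ℤ) ((6 : ℕ) : ℤ) = {-1, 0, 1, 2, 3, 4, 5, 6} := by rfl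
  have e2 : Finset.Icc (1 : ℤ) ((6 : ℕ) : ℤ) = {1, 2, 3, 4, 5, 6} := by rfl
  rw [vwpIntegrand, e1, e2]
  simp only [Finset.prod_insert, Finset.prod_singleton, Finset.mem_insert, Finset.mem_singleton,
    not_or, not_false_eq_true, reduceCtorEq, Int.reduceEq, Int.reduceNeg, and_self]
  ring

theorem stripBounded_vwpIntegrand_six {h : ℤ → ℂ} {c d : ℝ}
    (hc : ∀ j ∈ Finset.Icc (-1 : ℤ) 6, 0 < (h j).re + c) (h0 : d < 0)
    (hk : d < (h (-1) - h 0).re) : StripBounded c d (vwpIntegrand 6 h) (-(22 / 5)) := by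
  have hj : ∀ j ∈ Finset.Icc (-1 : ℤ) 6, StripBounded c d (fun z => Gamma (h j + z)) (-(3 / 2)) :=
    fun j hj => stripBounded_Gamma_add d (hc j hj)
  have hi : ∀ j, StripBounded c d (fun z => (Gamma (1 + h 0 - h j + z))⁻¹) (8 / 5) :=
    fun j => stripBounded_inv_Gamma_add _ c d
  have h1 : StripBounded c d (fun z => Gamma (-z)) (-(3 / 2)) := by
    simpa using stripBounded_Gamma_sub (a := 0) c (by simpa using h0)
  have h2 : StripBounded c d (fun z => Gamma (h (-1) - h 0 - z)) (-(3 / 2)) :=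
    stripBounded_Gamma_sub c (by linarith)
  rw [vwpIntegrand_six]
  simp only [div_eq_mul_inv, mul_inv]
  have := (((stripBounded_linear (h 0) 2 c d).mul ((((hj 0 (by decide)).mul h1).mul
    (hj (-1) (by decide))).mul h2)).mul ((((hj 4 (by decide)).mul (hj 5 (by decide))).mul
    (hj 6 (by decide))).mul (((hi 4).mul (hi 5)).mul (hi 6)))).mul
    ((((hj 1 (by decide)).mul (hj 2 (by decide))).mul
    (hj 3 (by decide))).mul (((hi 1).mul (hi 2)).mul (hi 3)))
  convert! this using 1
  norm_num

/-- The very-well-poised integral as a double integral, for arbitrary admissible parameters. -/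
theorem vwpIntegral_six_eq {h : ℤ → ℂ} {c d e : ℝ} (hh : AdmissibleParams 6 h)
    (hc : SeparatesVwp 6 h c) (hd : SeparatesTriple h 1 2 3 d) (he : SeparatesTriple h 4 5 6 e) :
    VerticalIntegrable c (vwpIntegrand 6 h) ∧
    vwpIntegral 6 h c = Gamma (h (-1)) *
      (Gamma (1 + h 0 - h 1 - h 2) * Gamma (1 + h 0 - h 1 - h 3) *
        Gamma (1 + h 0 - h 2 - h 3))⁻¹ *
      (Gamma (1 + h 0 - h 4 - h 5) * Gamma (1 + h 0 - h 4 - h 6) *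
        Gamma (1 + h 0 - h 5 - h 6))⁻¹ *
      doubleIntegral e d (tripleKernel (h 0) (h (-1)) (h 4) (h 5) (h 6))
        (tripleKernel (h 0) (h (-1)) (h 1) (h 2) (h 3)) (inverseBetaKernel (h 0) (h (-1))) := by
  obtain ⟨hc1, hc2, hc3⟩ := hc
  obtain ⟨⟨hd1, hd2, hd3⟩, hd4, hd5, hd6⟩ := hd
  obtain ⟨⟨he1, he2, he3⟩, he4, he5, he6⟩ := he
  have hb1 := hh 1 (by decide)
  have hb4 := hh 4 (by decide)
  have hm := max_lt_iff.1 hb1.1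
  have hpos : ∀ c', c ≤ c' → ∀ j ∈ Finset.Icc (-1 : ℤ) 6, 0 < (h j).re + c' := by
    intro c' hcc j hj
    have h1 := hc1 1 (by decide)
    have h2 := hm.2
    rw [sub_re] at h2
    rcases (by simp at hj; omega : j = -1 ∨ j = 0 ∨ (1 ≤ j ∧ j ≤ 6)) with rfl | rfl | hj
    · linarith
    · linarith
    · linarith [hc1 j (by simpa using hj)]
  -- The expansion of the triples needs a line to the right of `Re z = d` and `Re z = e`.
  obtain ⟨c', h1, h2⟩ := exists_between
    (show max c (max d e) < min 0 (h (-1) - h 0).re by simp_all)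
  obtain ⟨h3, h4⟩ := max_lt_iff.1 h1
  obtain ⟨h4, h5⟩ := max_lt_iff.1 h4
  obtain ⟨h6, h7⟩ := lt_min_iff.1 h2
  obtain ⟨hdiff, C, hC, hbd⟩ := stripBounded_vwpIntegrand_six (c := c) (d := c') (hpos c le_rfl)
    h6 h7
  have hbd' : ∀ z : ℂ, c ≤ z.re → z.re ≤ c' → ‖vwpIntegrand 6 h z‖ ≤ C * Real.exp (-|z.im|) := by
    intro z h1 h2
    refine (hbd z h1 h2).trans ?_
    gcongr
    linarith [abs_nonneg z.im]
  refine ⟨verticalIntegrable_of_norm_le (hdiff.continuousOn.mono fun z hz =>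
    ⟨hz.ge, hz.le.trans h3.le⟩) fun z hz => hbd' z hz.ge (hz.le.trans h3.le), ?_⟩
  rw [vwpIntegral, verticalIntegral_eq_of_strip h3.le hdiff hbd', vwpIntegrand_six]
  exact verticalIntegral_vwp_six hd1 hd2 hd3 he1 he2 he3 hd6 he6
    (by linarith [hb1.2]) (by linarith [hb4.2]) h4 h5 h6 h7

theorem doubleIntegrable_tripleKernel {h : ℤ → ℂ} {i j l i' j' l' : ℤ} {c d : ℝ}
    (hc : SeparatesTriple h i j l c) (hd : SeparatesTriple h i' j' l' d) :
    DoubleIntegrable c d (tripleKernel (h 0) (h (-1)) (h i) (h j) (h l))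
      (tripleKernel (h 0) (h (-1)) (h i') (h j') (h l')) (inverseBetaKernel (h 0) (h (-1))) := by
  obtain ⟨⟨hd1, hd2, hd3⟩, hd4, hd5, hd6⟩ := hd
  obtain ⟨⟨hc1, hc2, hc3⟩, hc4, hc5, hc6⟩ := hc
  have hA := expBounded_tripleKernel hc1 hc2 hc3 hc4 hc5 hc6
  have hB := expBounded_tripleKernel hd1 hd2 hd3 hd4 hd5 hd6
  constructor
  · intro y
    refine ExpBounded.integrable (hB.mul (expBounded_inverseBetaKernel (h 0) (h (-1)) (d + c)
      (l := fun x => x + y) (by fun_prop) fun x => by push_cast; ring)) (δ := 1)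
      (D := 16 / 5 * |y|) one_pos fun x => ?_
    linarith [abs_add_le x y, abs_nonneg x]
  · have hA' : ExpBounded (fun p : ℝ × ℝ => tripleKernel (h 0) (h (-1)) (h i) (h j) (h l)
        (c + p.1 * I)) (fun p => -9 * |p.1|) := by
      obtain ⟨h1, C, h2, h3⟩ := hA
      exact ⟨h1.comp continuous_fst, C, h2, fun p => h3 p.1⟩
    have hB' : ExpBounded (fun p : ℝ × ℝ => tripleKernel (h 0) (h (-1)) (h i') (h j') (h l')
        (d + p.2 * I)) (fun p => -9 * |p.2|) := by
      obtain ⟨h1, C, h2, h3⟩ := hB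
      exact ⟨h1.comp continuous_snd, C, h2, fun p => h3 p.2⟩
    refine ExpBounded.integrable_prod (hA'.mul (hB'.mul (expBounded_inverseBetaKernel (h 0)
      (h (-1)) (d + c) (l := fun p => p.2 + p.1) (by fun_prop) fun p => by push_cast; ring)))
      (δ := 1) (D := 0) one_pos fun p => ?_
    linarith [abs_add_le p.2 p.1, abs_nonneg p.1, abs_nonneg p.2]

/-! ### Changing the integrand off the real axis -/

/-- Kernels that are proportional off the real axis give proportional double integrals. On the
real axis the quotients by `sin πz` and the values of `Γ` at its poles are junk. -/
theorem doubleIntegral_of_eq_const_mul {ct cs : ℝ} {A B K A' B' K' : ℂ → ℂ} {a b k : ℂ}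
    (hA : ∀ z, z.im ≠ 0 → A z = a * A' z) (hB : ∀ z, z.im ≠ 0 → B z = b * B' z)
    (hK : ∀ z, z.im ≠ 0 → K z = k * K' z) :
    (DoubleIntegrable ct cs A' B' K' → DoubleIntegrable ct cs A B K) ∧
    doubleIntegral ct cs A B K = a * b * k * doubleIntegral ct cs A' B' K' := by
  have hne : ∀ x : ℝ, ∀ᵐ y : ℝ, y ≠ x := fun x => by simp [ae_iff]
  have hinner : ∀ t : ℂ, ∀ᵐ y : ℝ, B (cs + y * I) * K (cs + y * I + t) =
      b * k * (B' (cs + y * I) * K' (cs + y * I + t)) := by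
    intro t
    filter_upwards [hne 0, hne (-t.im)] with y h1 h2
    rw [hB _ (by simpa using h1), hK _ (by simpa [← eq_neg_iff_add_eq_zero] using h2)]
    ring
  refine ⟨fun h => ⟨fun y => ?_, ?_⟩, ?_⟩
  · exact ((h.1 y).const_mul (b * k)).congr ((hinner _).mono fun x hx => hx.symm)
  · refine (h.2.const_mul (a * b * k)).congr ?_
    have h1 : ∀ᵐ p : ℝ × ℝ ∂(volume.prod volume), p.1 ≠ 0 :=
      Measure.quasiMeasurePreserving_fst.ae (hne 0)
    have h2 : ∀ᵐ p : ℝ × ℝ ∂(volume.prod volume), p.2 ≠ 0 :=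
      Measure.quasiMeasurePreserving_snd.ae (hne 0)
    have h3 : ∀ᵐ p : ℝ × ℝ ∂(volume.prod volume), p.2 + p.1 ≠ 0 := by
      have hms : MeasurableSet {p : ℝ × ℝ | p.2 + p.1 ≠ 0} :=
        (measurableSet_eq_fun (by fun_prop) measurable_const).compl
      refine (Measure.ae_prod_mem_iff_ae_ae_mem hms).2 (Eventually.of_forall fun x => ?_)
      filter_upwards [hne (-x)] with y hy
      simpa [← eq_neg_iff_add_eq_zero] using hy
    filter_upwards [h1, h2, h3] with p h1 h2 h3
    rw [hA _ (by simpa using h1), hB _ (by simpa using h2), hK _ (by simpa using h3)]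
    ring
  · rw [doubleIntegral, doubleIntegral, ← verticalIntegral_const_mul, verticalIntegral_eq,
      verticalIntegral_eq]
    congr 1
    refine integral_congr_ae ?_
    filter_upwards [hne 0] with y hy
    have : ∀ t : ℂ, verticalIntegral cs (fun s => B s * K (s + t)) =
        b * k * verticalIntegral cs (fun s => B' s * K' (s + t)) := by
      intro t
      rw [← verticalIntegral_const_mul, verticalIntegral_eq, verticalIntegral_eq,
        integral_congr_ae (hinner t)]
    rw [hA _ (by simpa using hy), this]
    ring

theorem sin_pi_mul_ne_zero {z : ℂ} (hz : z.im ≠ 0) : sin (Real.pi * z) ≠ 0 := by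
  rw [Ne, Complex.sin_eq_zero_iff]
  rintro ⟨k, hk⟩
  rw [mul_comm] at hk
  have := mul_right_cancel₀ (ofReal_ne_zero.2 Real.pi_ne_zero) hk
  rw [this] at hz
  simp at hz

theorem Gamma_ne_zero_of_im_ne_zero {z : ℂ} (hz : z.im ≠ 0) : Gamma z ≠ 0 :=
  Gamma_ne_zero fun m hm => hz (by rw [hm]; simp)

theorem neg_one_zpow_mul_self (n : ℤ) : (-1 : ℂ) ^ n * (-1 : ℂ) ^ n = 1 := by
  rw [← mul_zpow]; simp

/-- The reflection formula shifted by an integer. -/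
theorem Gamma_int_sub {z : ℂ} (hz : z.im ≠ 0) (n : ℤ) :
    Gamma (n - z) = (-1) ^ (n + 1) * (Real.pi / sin (Real.pi * z)) / Gamma (1 - n + z) := by
  have h1 := Complex.Gamma_mul_Gamma_one_sub (n - z)
  have h2 : Gamma (1 - n + z) ≠ 0 := Gamma_ne_zero_of_im_ne_zero (by simpa using hz)
  have h3 := sin_pi_mul_ne_zero hz
  have h4 : sin (Real.pi * (n - z)) = (-1) ^ (n + 1) * sin (Real.pi * z) := by
    have h : sin ((n : ℂ) * Real.pi - Real.pi * z) = -((-1) ^ n * sin (Real.pi * z)) := by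
      simpa only [Complex.sin_neg, mul_neg, Int.cast_negOnePow] using
        Complex.sin_antiperiodic.int_mul_sub_eq n (x := Real.pi * z)
    rw [mul_sub, mul_comm (Real.pi : ℂ) n, h, zpow_add_one₀ (by norm_num)]
    ring
  have h5 := neg_one_zpow_mul_self (n + 1)
  have h6 : ((-1 : ℂ) ^ (n + 1)) ≠ 0 := zpow_ne_zero _ (by norm_num)
  rw [show 1 - (n - z) = 1 - n + z by ring, h4] at h1
  rw [eq_div_iff h2, h1]
  field_simp
  linear_combination -h5

/-- The three factors `π / sin πz` come from the reflection of `Γ(-z)`, `Γ(h₋₁ - h₀ - z)` and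
`Γ(1 + h₀ - h_i - h_j - h_l - z)`, whose arguments differ from `-z` by integers. -/
theorem gammaFactor_eq {h : ℤ → ℂ} {m N i j l : ℤ} (hm : h (-1) - h 0 = m)
    (hN : h 0 - h i - h j - h l = N) {z : ℂ} (hz : z.im ≠ 0) :
    gammaFactor h i j l z =
      (-1) ^ (m + N) * tripleKernel (h 0) (h (-1)) (h i) (h j) (h l) z := by
  have e0 := Gamma_int_sub hz 0
  have em := Gamma_int_sub hz m
  have eN := Gamma_int_sub hz (1 + N)
  rw [← hm, show 1 - (h (-1) - h 0) + z = 1 + h 0 - h (-1) + z by ring] at em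
  push_cast at e0 eN
  rw [← hN, show 1 + (h 0 - h i - h j - h l) = 1 + h 0 - h i - h j - h l by ring,
    show 1 - (1 + h 0 - h i - h j - h l) + z = h i + h j + h l - h 0 + z by ring] at eN
  rw [zero_sub, sub_zero, zpow_one] at e0
  rw [tripleKernel, e0, em, eN, gammaFactor]
  have s1 : (-1 : ℂ) ^ (m + N) * ((-1) ^ (1 + N + 1) * (-1 * (-1) ^ (m + 1))) = 1 := by
    rw [zpow_add₀ (by norm_num), zpow_add₀ (by norm_num), zpow_add₀ (by norm_num),
      zpow_add₀ (by norm_num), zpow_one]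
    linear_combination ((-1 : ℂ) ^ N * (-1 : ℂ) ^ N) * neg_one_zpow_mul_self m +
      neg_one_zpow_mul_self N
  simp only [div_eq_mul_inv, mul_inv]
  linear_combination (-(Gamma (h i + z) * Gamma (h j + z) * Gamma (h l + z) *
    ((Gamma (1 + z))⁻¹ * (Gamma (1 + h 0 - h (-1) + z))⁻¹ *
      (Gamma (h i + h j + h l - h 0 + z))⁻¹) * (Real.pi * (sin (Real.pi * z))⁻¹) ^ 3)) * s1

theorem gammaCoupling_eq {h : ℤ → ℂ} {m : ℤ} (hm : h (-1) - h 0 = m) {x : ℂ} (hx : x.im ≠ 0) :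
    gammaCoupling h x = (-1) ^ (m + 1) * inverseBetaKernel (h 0) (h (-1)) x := by
  have em := Gamma_int_sub hx m
  have h1 := neg_one_zpow_mul_self (m + 1)
  rw [← hm, show 1 - (h (-1) - h 0) + x = 1 + h 0 - h (-1) + x by ring] at em
  have h2 : Gamma (1 + h 0 - h (-1) + x) ≠ 0 := Gamma_ne_zero_of_im_ne_zero (by
    rw [show 1 + h 0 - h (-1) + x = 1 - (m : ℂ) + x by rw [← hm]; ring]; simpa using hx)
  rw [inverseBetaKernel, em, gammaCoupling]
  have hs := sin_pi_mul_ne_zero hx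
  have hp : (Real.pi : ℂ) ≠ 0 := ofReal_ne_zero.2 Real.pi_ne_zero
  simp only [div_eq_mul_inv, mul_inv, inv_inv]
  rw [inv_eq_of_mul_eq_one_left h1]
  linear_combination (-(Gamma (1 + h 0 - h (-1) + x) * (Gamma (1 + h 0 + x))⁻¹ *
    (sin (Real.pi * x) * (Real.pi : ℂ)⁻¹))) * h1

theorem vwpIntegral_six_eq_gamma {h : ℤ → ℂ} {m N₁ N₂ : ℤ} {c cs ct : ℝ}
    (hh : AdmissibleParams 6 h) (hm : h (-1) - h 0 = m) (h₁ : h 0 - h 1 - h 2 - h 3 = N₁)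
    (h₂ : h 0 - h 4 - h 5 - h 6 = N₂) (hc : SeparatesVwp 6 h c)
    (hcs : SeparatesTriple h 1 2 3 cs) (hct : SeparatesTriple h 4 5 6 ct) :
    VerticalIntegrable c (vwpIntegrand 6 h) ∧
      DoubleIntegrable ct cs (gammaFactor h 4 5 6) (gammaFactor h 1 2 3) (gammaCoupling h) ∧
      vwpIntegral 6 h c =
        (-1 : ℂ) ^ (m + N₁ + N₂ + 1) * Gamma (h (-1)) /
          (Gamma (1 + h 0 - h 1 - h 2) * Gamma (1 + h 0 - h 1 - h 3) *
            Gamma (1 + h 0 - h 2 - h 3)) *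
        (1 / (Gamma (1 + h 0 - h 4 - h 5) * Gamma (1 + h 0 - h 4 - h 6) *
            Gamma (1 + h 0 - h 5 - h 6))) *
        doubleIntegral ct cs (gammaFactor h 4 5 6) (gammaFactor h 1 2 3) (gammaCoupling h) := by
  obtain ⟨hint, heq⟩ := vwpIntegral_six_eq hh hc hcs hct
  obtain ⟨h3, h4⟩ := doubleIntegral_of_eq_const_mul (ct := ct) (cs := cs)
    (fun z hz => gammaFactor_eq hm h₂ hz) (fun z hz => gammaFactor_eq hm h₁ hz)
    (fun z hz => gammaCoupling_eq hm hz)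
  refine ⟨hint, h3 (doubleIntegrable_tripleKernel hct hcs), ?_⟩
  have hsign : (-1 : ℂ) ^ (m + N₁ + N₂ + 1) *
      ((-1) ^ (m + N₂) * (-1) ^ (m + N₁) * (-1) ^ (m + 1)) = 1 := by
    simp only [zpow_add₀ (show (-1 : ℂ) ≠ 0 by norm_num), zpow_one]
    have em := neg_one_zpow_mul_self m
    have e1 := neg_one_zpow_mul_self N₁
    have e2 := neg_one_zpow_mul_self N₂
    linear_combination ((-1 : ℂ) ^ m * (-1 : ℂ) ^ m * ((-1 : ℂ) ^ N₁ * (-1 : ℂ) ^ N₁) *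
      ((-1 : ℂ) ^ N₂ * (-1 : ℂ) ^ N₂) + ((-1 : ℂ) ^ N₁ * (-1 : ℂ) ^ N₁) *
      ((-1 : ℂ) ^ N₂ * (-1 : ℂ) ^ N₂)) * em + ((-1 : ℂ) ^ N₂ * (-1 : ℂ) ^ N₂) * e1 + e2
  rw [heq, h4]
  simp only [div_eq_mul_inv, one_mul]
  generalize doubleIntegral ct cs _ _ _ = D
  linear_combination (-(Gamma (h (-1)) *
      (Gamma (1 + h 0 - h 1 - h 2) * Gamma (1 + h 0 - h 1 - h 3) *
        Gamma (1 + h 0 - h 2 - h 3))⁻¹ *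
      (Gamma (1 + h 0 - h 4 - h 5) * Gamma (1 + h 0 - h 4 - h 6) *
        Gamma (1 + h 0 - h 5 - h 6))⁻¹ * D)) * hsign

/-! ### Integer parameters -/

theorem Gamma_one_add_intCast {n : ℤ} (hn : 0 ≤ n) : Gamma (1 + n) = intFactorial n := by
  obtain ⟨k, rfl⟩ := Int.eq_ofNat_of_zero_le hn
  simp [intFactorial, add_comm (1 : ℂ), Complex.Gamma_nat_eq_factorial]

theorem intFactorial_ne_zero (n : ℤ) : intFactorial n ≠ 0 :=
  Nat.cast_ne_zero.2 (Nat.factorial_ne_zero _)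

theorem Gamma_add_intCast_div_Gamma {z : ℂ} (hz : z.im ≠ 0) {n : ℤ} (hn : 0 ≤ n) :
    Gamma (z + n) / Gamma z = pochhammer z n := by
  obtain ⟨k, rfl⟩ := Int.eq_ofNat_of_zero_le hn
  rw [pochhammer, ← Complex.Gamma_add_nat_div_Gamma_eq z fun k hk => hz (by rw [hk]; simp)]
  simp

theorem pochFactor_eq {h : ℤ → ℤ} {i j l : ℤ} (hi : 1 ≤ h i) (hil : h i + h l ≤ h 0)
    (hl : h 0 - h (-1) < h l) {z : ℂ} (hz : z.im ≠ 0) :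
    pochFactor h i j l z = 1 / (intFactorial (h i - 1) * intFactorial (h 0 - h i - h l) *
      intFactorial (h l + h (-1) - h 0 - 1)) * gammaFactor (castParams h) i j l z := by
  have e1 := Gamma_add_intCast_div_Gamma (z := z + 1) (n := h i - 1) (by simpa using hz)
    (by linarith)
  have e2 := Gamma_add_intCast_div_Gamma (z := z + h i + h j + h l - h 0)
    (n := h 0 - h i - h l) (by simpa using hz) (by linarith)
  have e3 := Gamma_add_intCast_div_Gamma (z := z + 1 + h 0 - h (-1))
    (n := h l + h (-1) - h 0 - 1) (by simpa using hz) (by linarith)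
  rw [pochFactor, ← e1, ← e2, ← e3, gammaFactor]
  simp only [castParams]
  push_cast
  rw [show z + 1 + ((h i : ℂ) - 1) = h i + z by ring,
    show z + h i + h j + h l - h 0 + ((h 0 : ℂ) - h i - h l) = h j + z by ring,
    show z + 1 + h 0 - h (-1) + ((h l : ℂ) + h (-1) - h 0 - 1) = h l + z by ring,
    show z + 1 = 1 + z by ring, show 1 + z + (h 0 : ℂ) - h (-1) = 1 + h 0 - h (-1) + z by ring,
    show z + h i + h j + h l - (h 0 : ℂ) = h i + h j + h l - h 0 + z by ring]
  simp only [div_eq_mul_inv, mul_inv]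
  ring

theorem pochCoupling_eq {h : ℤ → ℤ} (hk : 0 < h (-1)) {x : ℂ} (hx : x.im ≠ 0) :
    pochCoupling h x = intFactorial (h (-1) - 1) * gammaCoupling (castParams h) x := by
  have e := Gamma_add_intCast_div_Gamma (z := x + 1 + h 0 - h (-1)) (n := h (-1))
    (by simpa using hx) hk.le
  rw [pochCoupling, ← e, gammaCoupling]
  simp only [castParams]
  rw [show x + 1 + h 0 - h (-1) + (h (-1) : ℂ) = 1 + h 0 + x by ring,
    show x + 1 + h 0 - (h (-1) : ℂ) = 1 + h 0 - h (-1) + x by ring]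
  rw [div_div_eq_mul_div]
  ring

/-- The permutation of the indices that turns the triples `(1, 2, 3)` and `(4, 5, 6)` into
`(1, 3, 5)` and `(2, 4, 6)`. -/
def unshuffle (j : ℤ) : ℤ :=
  if j = 2 then 3 else if j = 3 then 5 else if j = 4 then 2 else if j = 5 then 4 else j

theorem vwpIntegrand_six_unshuffle (h : ℤ → ℂ) :
    vwpIntegrand 6 (fun j => h (unshuffle j)) = vwpIntegrand 6 h := by
  rw [vwpIntegrand_six, vwpIntegrand_six]
  ext t
  simp only [unshuffle]
  norm_num
  simp only [div_eq_mul_inv, mul_inv]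
  ring

theorem unshuffle_mem {j : ℤ} (hj : j ∈ Finset.Icc (1 : ℤ) 6) :
    unshuffle j ∈ Finset.Icc (1 : ℤ) 6 := by
  simp only [Finset.mem_Icc, unshuffle] at *
  split_ifs <;> omega

theorem normalizedIntegral_eq_gamma {h : ℤ → ℤ} {c cs ct : ℝ} (hh : AdmissibleIntParams h)
    (hc : SeparatesVwp 6 (castParams h) c) (hcs : SeparatesTriple (castParams h) 1 3 5 cs)
    (hct : SeparatesTriple (castParams h) 2 4 6 ct) :
    VerticalIntegrable c (vwpIntegrand 6 (castParams h)) ∧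
      DoubleIntegrable ct cs (gammaFactor (castParams h) 2 4 6)
        (gammaFactor (castParams h) 1 3 5) (gammaCoupling (castParams h)) ∧
      normalizedIntegral h c =
        (-1 : ℂ) ^ ((∑ j ∈ Finset.Icc (-1 : ℤ) 6, h j) + 1) *
          intFactorial (h (-1) - 1) * gammaNorm h /
          (intFactorial (h 0 - h 1 - h 3) * intFactorial (h 0 - h 1 - h 5) *
            intFactorial (h 0 - h 3 - h 5)) *
        (1 / (intFactorial (h 0 - h 2 - h 4) * intFactorial (h 0 - h 2 - h 6) *
            intFactorial (h 0 - h 4 - h 6))) *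
        doubleIntegral ct cs (gammaFactor (castParams h) 2 4 6)
          (gammaFactor (castParams h) 1 3 5) (gammaCoupling (castParams h)) := by
  obtain ⟨hpos, hj⟩ := hh
  have u0 : unshuffle 0 = 0 := by decide
  have uk : unshuffle (-1) = -1 := by decide
  have u1 : unshuffle 1 = 1 := by decide
  have u2 : unshuffle 2 = 3 := by decide
  have u3 : unshuffle 3 = 5 := by decide
  have u4 : unshuffle 4 = 2 := by decide
  have u5 : unshuffle 5 = 4 := by decide
  have u6 : unshuffle 6 = 6 := by decide
  have key := vwpIntegral_six_eq_gamma (h := fun j => castParams h (unshuffle j))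
    (m := h (-1) - h 0) (N₁ := h 0 - h 1 - h 3 - h 5) (N₂ := h 0 - h 2 - h 4 - h 6)
    (c := c) (cs := cs) (ct := ct) (by
      intro j hj'
      have hu := unshuffle_mem hj'
      have h1 := hj _ hu
      have h2 := hpos _ (Finset.Icc_subset_Icc_left (by norm_num) hu)
      have e1 : ((h 0 - h (-1) : ℤ) : ℝ) < h (unshuffle j) := by exact_mod_cast h1.1
      have e2 : ((2 * h (unshuffle j) : ℤ) : ℝ) < h 0 := by exact_mod_cast h1.2
      have e3 : (0 : ℝ) < h (unshuffle j) := by exact_mod_cast h2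
      push_cast at e1 e2
      simp only [u0, uk, castParams, sub_re, intCast_re]
      exact ⟨max_lt e3 e1, by linarith⟩)
    (by simp only [u0, uk, castParams]; push_cast; ring)
    (by simp only [u0, u1, u2, u3, castParams]; push_cast; ring)
    (by simp only [u0, u4, u5, u6, castParams]; push_cast; ring)
    (by
      obtain ⟨h1, h2, h3⟩ := hc
      exact ⟨fun j hj' => h1 _ (unshuffle_mem hj'), h2, by simpa only [u0, uk] using h3⟩)
    (by simpa only [SeparatesTriple, u0, uk, u1, u2, u3] using hcs)
    (by simpa only [SeparatesTriple, u0, uk, u4, u5, u6] using hct)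
  rw [vwpIntegral, vwpIntegrand_six_unshuffle, ← vwpIntegral] at key
  have g1 : gammaFactor (fun j => castParams h (unshuffle j)) 4 5 6 =
      gammaFactor (castParams h) 2 4 6 := by
    ext z; simp only [gammaFactor, u0, uk, u4, u5, u6]
  have g2 : gammaFactor (fun j => castParams h (unshuffle j)) 1 2 3 =
      gammaFactor (castParams h) 1 3 5 := by
    ext z; simp only [gammaFactor, u0, uk, u1, u2, u3]
  have g3 : gammaCoupling (fun j => castParams h (unshuffle j)) =
      gammaCoupling (castParams h) := by
    ext z; simp only [gammaCoupling, u0, uk]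
  rw [g1, g2, g3] at key
  refine ⟨key.1, key.2.1, ?_⟩
  have hfac : ∀ i ∈ Finset.Icc (1 : ℤ) 6, ∀ j ∈ Finset.Icc (1 : ℤ) 6,
      Gamma (1 + (h 0 : ℂ) - h i - h j) = intFactorial (h 0 - h i - h j) := by
    intro i hi j hj'
    have h1 := (hj i hi).2
    have h2 := (hj j hj').2
    rw [← Gamma_one_add_intCast (by linarith)]
    push_cast
    congr 1
    ring
  have hk : Gamma (h (-1) : ℂ) = intFactorial (h (-1) - 1) := by
    rw [← Gamma_one_add_intCast (by have := hpos (-1) (by decide); linarith)]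
    push_cast
    congr 1
    ring
  have hsign : (-1 : ℂ) ^ (h (-1) - h 0 + (h 0 - h 1 - h 3 - h 5) + (h 0 - h 2 - h 4 - h 6) + 1) =
      (-1 : ℂ) ^ ((∑ j ∈ Finset.Icc (-1 : ℤ) 6, h j) + 1) := by
    have e1 : Finset.Icc (-1 : ℤ) 6 = {-1, 0, 1, 2, 3, 4, 5, 6} := by rfl
    rw [e1]
    simp only [Finset.sum_insert, Finset.sum_singleton, Finset.mem_insert, Finset.mem_singleton,
      not_or, not_false_eq_true, reduceCtorEq, Int.reduceEq, Int.reduceNeg, and_self]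
    set n := h 1 + h 2 + h 3 + h 4 + h 5 + h 6 with hn
    rw [show h (-1) + (h 0 + (h 1 + (h 2 + (h 3 + (h 4 + (h 5 + h 6)))))) + 1 =
      (h (-1) - h 0 + (h 0 - h 1 - h 3 - h 5) + (h 0 - h 2 - h 4 - h 6) + 1) + (n + n) by
        rw [hn]; ring, zpow_add₀ (by norm_num) _ (n + n), zpow_add₀ (by norm_num) n n,
      neg_one_zpow_mul_self, mul_one]
  rw [normalizedIntegral, key.2.2, hsign]
  simp only [u0, uk, u1, u2, u3, u4, u5, u6, castParams]
  rw [hk, hfac 1 (by decide) 3 (by decide), hfac 1 (by decide) 5 (by decide),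
    hfac 3 (by decide) 5 (by decide), hfac 2 (by decide) 4 (by decide),
    hfac 2 (by decide) 6 (by decide), hfac 4 (by decide) 6 (by decide)]
  ring

end BarnesZeta4

theorem mainTheorem4 :
    (∀ (h : ℤ → ℂ) (m N₁ N₂ : ℤ) (c cs ct : ℝ),
      BarnesZeta4.AdmissibleParams 6 h →
      h (-1) - h 0 = (m : ℂ) →
      h 0 - h 1 - h 2 - h 3 = (N₁ : ℂ) →
      h 0 - h 4 - h 5 - h 6 = (N₂ : ℂ) →
      BarnesZeta4.SeparatesVwp 6 h c →
      BarnesZeta4.SeparatesTriple h 1 2 3 cs →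
      BarnesZeta4.SeparatesTriple h 4 5 6 ct →
      BarnesZeta4.VerticalIntegrable c (BarnesZeta4.vwpIntegrand 6 h) ∧
      BarnesZeta4.DoubleIntegrable ct cs (BarnesZeta4.gammaFactor h 4 5 6)
        (BarnesZeta4.gammaFactor h 1 2 3) (BarnesZeta4.gammaCoupling h) ∧
      BarnesZeta4.vwpIntegral 6 h c =
        (-1 : ℂ) ^ (m + N₁ + N₂ + 1) * Complex.Gamma (h (-1)) /
          (Complex.Gamma (1 + h 0 - h 1 - h 2) * Complex.Gamma (1 + h 0 - h 1 - h 3) *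
            Complex.Gamma (1 + h 0 - h 2 - h 3)) *
        (1 / (Complex.Gamma (1 + h 0 - h 4 - h 5) * Complex.Gamma (1 + h 0 - h 4 - h 6) *
            Complex.Gamma (1 + h 0 - h 5 - h 6))) *
        BarnesZeta4.doubleIntegral ct cs (BarnesZeta4.gammaFactor h 4 5 6)
          (BarnesZeta4.gammaFactor h 1 2 3) (BarnesZeta4.gammaCoupling h)) ∧
    (∀ (h : ℤ → ℤ) (c cs ct : ℝ),
      BarnesZeta4.AdmissibleIntParams h →
      BarnesZeta4.SeparatesVwp 6 (BarnesZeta4.castParams h) c →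
      BarnesZeta4.SeparatesTriple (BarnesZeta4.castParams h) 1 3 5 cs →
      BarnesZeta4.SeparatesTriple (BarnesZeta4.castParams h) 2 4 6 ct →
      BarnesZeta4.VerticalIntegrable c
        (BarnesZeta4.vwpIntegrand 6 (BarnesZeta4.castParams h)) ∧
      BarnesZeta4.DoubleIntegrable ct cs
        (BarnesZeta4.gammaFactor (BarnesZeta4.castParams h) 2 4 6)
        (BarnesZeta4.gammaFactor (BarnesZeta4.castParams h) 1 3 5)
        (BarnesZeta4.gammaCoupling (BarnesZeta4.castParams h)) ∧
      BarnesZeta4.DoubleIntegrable ct cs (BarnesZeta4.pochFactor h 2 4 6)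
        (BarnesZeta4.pochFactor h 1 3 5) (BarnesZeta4.pochCoupling h) ∧
      BarnesZeta4.normalizedIntegral h c =
        (-1 : ℂ) ^ ((∑ j ∈ Finset.Icc (-1 : ℤ) 6, h j) + 1) *
          BarnesZeta4.intFactorial (h (-1) - 1) * BarnesZeta4.gammaNorm h /
          (BarnesZeta4.intFactorial (h 0 - h 1 - h 3) *
            BarnesZeta4.intFactorial (h 0 - h 1 - h 5) *
            BarnesZeta4.intFactorial (h 0 - h 3 - h 5)) *
        (1 / (BarnesZeta4.intFactorial (h 0 - h 2 - h 4) *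
            BarnesZeta4.intFactorial (h 0 - h 2 - h 6) *
            BarnesZeta4.intFactorial (h 0 - h 4 - h 6))) *
        BarnesZeta4.doubleIntegral ct cs
          (BarnesZeta4.gammaFactor (BarnesZeta4.castParams h) 2 4 6)
          (BarnesZeta4.gammaFactor (BarnesZeta4.castParams h) 1 3 5)
          (BarnesZeta4.gammaCoupling (BarnesZeta4.castParams h)) ∧
      BarnesZeta4.normalizedIntegral h c =
        (-1 : ℂ) ^ ((∑ j ∈ Finset.Icc (-1 : ℤ) 6, h j) + 1) *
        BarnesZeta4.doubleIntegral ct cs (BarnesZeta4.pochFactor h 2 4 6)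
          (BarnesZeta4.pochFactor h 1 3 5) (BarnesZeta4.pochCoupling h)) := by
  refine ⟨fun h m N₁ N₂ c cs ct hh hm h₁ h₂ hc hcs hct =>
    BarnesZeta4.vwpIntegral_six_eq_gamma hh hm h₁ h₂ hc hcs hct, fun h c cs ct hh hc hcs hct => ?_⟩
  obtain ⟨h1, h2, h3⟩ := BarnesZeta4.normalizedIntegral_eq_gamma hh hc hcs hct
  have hpos : ∀ j ∈ Finset.Icc (1 : ℤ) 6, 1 ≤ h j := fun j hj =>
    hh.1 j (Finset.Icc_subset_Icc_left (by norm_num) hj)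
  have hle : ∀ i ∈ Finset.Icc (1 : ℤ) 6, ∀ j ∈ Finset.Icc (1 : ℤ) 6, h i + h j ≤ h 0 :=
    fun i hi j hj => by linarith [(hh.2 i hi).2, (hh.2 j hj).2]
  obtain ⟨h4, h5⟩ := BarnesZeta4.doubleIntegral_of_eq_const_mul (ct := ct) (cs := cs)
    (fun z hz => BarnesZeta4.pochFactor_eq (j := 4) (hpos 2 (by decide))
      (hle 2 (by decide) 6 (by decide)) (hh.2 6 (by decide)).1 hz)
    (fun z hz => BarnesZeta4.pochFactor_eq (j := 3) (hpos 1 (by decide))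
      (hle 1 (by decide) 5 (by decide)) (hh.2 5 (by decide)).1 hz)
    (fun z hz => BarnesZeta4.pochCoupling_eq (hh.1 (-1) (by decide)) hz)
  refine ⟨h1, h2, h4 h2, h3, ?_⟩
  rw [h3, h5, BarnesZeta4.gammaNorm]
  have hf := BarnesZeta4.intFactorial_ne_zero
  have f1 := hf (h 0 - h 2 - h 4)
  have f2 := hf (h 0 - h 1 - h 3)
  have f3 := hf (h 0 - h 4 - h 6)
  have f4 := hf (h 0 - h 3 - h 5)
  field_simp
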